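/- A graph $(G,V,E)$ is a compact connected CW complex $G$ of dimension at most one, together with its set $V$ of $0$-cells (vertices) and its set $E$ of $1$-cells (edges); loops and multiple edges are allowed. For $n \ge 0$, the $n$-th sink configuration space of $(G,V,E)$ is the subspace $$\mathrm{Conf}_n^{\mathrm{sink}}(G,V) = \{(x_1,\ldots,x_n)\in G^n \mid \text{for all } i\neq j:\ x_i\neq x_j \text{ or } x_i=x_j\in V\}$$ of $G^n$. For every graph $(G,V,E)$ and every integer $n \ge 0$, the integral singular homology groups of $\mathrm{Conf}_n^{\mathrm{sink}}(G,V)$ are finitely generated and only finitely many of them are nonzero, and its Euler characteristic is $$\chi\big(\mathrm{Conf}_n^{\mathrm{sink}}(G,V)\big) = \sum_{q\ge 0}(-1)^q\,\mathrm{rank}_{\mathbb Z}\, H_q\big(\mathrm{Conf}_n^{\mathrm{sink}}(G,V);\mathbb Z\big) = \sum_{i=0}^{|E|}(-1)^i\binom{n}{i}\binom{|E|}{i}\,i!\,|V|^{n-i},$$ where terms with $i>n$ are zero. In particular, the Euler characteristic depends only on $n$, $|E|$ and $|V|$: if $(G',V',E')$ is another graph with $|E'|=|E|$ and $|V'|=|V|$,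 then $\mathrm{Conf}_n^{\mathrm{sink}}(G,V)$ and $\mathrm{Conf}_n^{\mathrm{sink}}(G',V')$ have the same Euler characteristic. -/

import Mathlib

open CategoryTheory Topology

universe u v

noncomputable section

/-- A graph `(G, V, E)`: a compact connected (Hausdorff) space with a CW structure without cells of
dimension two or more. Loops and multiple edges are allowed. -/
structure CWGraph where
  carrier : Type u
  [topologicalSpace : TopologicalSpace carrier]
  [t2Space : T2Space carrier]
  [compactSpace : CompactSpace carrier]
  [connectedSpace : ConnectedSpace carrier]
  [cwComplex : CWComplex (Set.univ : Set carrier)]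
  isEmpty_cell : ∀ m : ℕ, 2 ≤ m → IsEmpty (RelCWComplex.cell (Set.univ : Set carrier) m)

namespace CWGraph

attribute [instance] topologicalSpace t2Space compactSpace connectedSpace cwComplex

/-- The type `V` of vertices (0-cells). -/
def V (G : CWGraph.{u}) : Type u := RelCWComplex.cell (Set.univ : Set G.carrier) 0

/-- The type `E` of edges (1-cells). -/
def E (G : CWGraph.{u}) : Type u := RelCWComplex.cell (Set.univ : Set G.carrier) 1

/-- The set of points of `G` that are vertices. -/
def vertexSet (G : CWGraph.{u}) : Set G.carrier :=
  ⋃ v : G.V, RelCWComplex.closedCell (C := (Set.univ : Set G.carrier)) 0 v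

/-- The sink configuration space, with the topology induced from `G ^ n`: two coordinates with
different indices may coincide only at a vertex. -/
def sinkConf (G : CWGraph.{u}) (n : ℕ) : Set (Fin n → G.carrier) :=
  {x | ∀ i j : Fin n, i ≠ j → x i ≠ x j ∨ (x i = x j ∧ x i ∈ G.vertexSet)}

/-- A set of points meeting every open cell in at most one point is closed: all its traces on closed
cells are finite. -/
lemma isClosed_of_subsingleton_inter (G : CWGraph.{u}) (A : Set G.carrier)
    (hA : ∀ (m : ℕ) (e : RelCWComplex.cell (Set.univ : Set G.carrier) m),
      (A ∩ RelCWComplex.openCell m e).Subsingleton) : IsClosed A := by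
  rw [CWComplex.closed (Set.univ : Set G.carrier) A (Set.subset_univ _)]
  intro m e
  apply Set.Finite.isClosed
  rw [← RelCWComplex.cellFrontier_union_openCell_eq_closedCell, Set.inter_union_distrib_left]
  refine Set.Finite.union ?_ (hA m e).finite
  obtain ⟨I, hI⟩ := CWComplex.cellFrontier_subset_finite_openCell m e
  refine Set.Finite.subset (s := ⋃ k ∈ Set.Iio m, ⋃ j ∈ (↑(I k) : Set (RelCWComplex.cell (Set.univ : Set G.carrier) k)),
    A ∩ RelCWComplex.openCell k j) ?_ ?_
  · exact (Set.finite_Iio m).biUnion fun k _ => (I k).finite_toSet.biUnion fun j _ => (hA k j).finite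
  · rintro x ⟨hxA, hx⟩
    have := hI hx
    simp only [Set.mem_iUnion, exists_prop] at this ⊢
    obtain ⟨k, hk, j, hj, hxj⟩ := this
    exact ⟨k, hk, j, hj, hxA, hxj⟩

/-- Compactness leaves only finitely many cells in each dimension. -/
lemma finite_cell (G : CWGraph.{u}) (m : ℕ) :
    Finite (RelCWComplex.cell (Set.univ : Set G.carrier) m) := by
  let c : RelCWComplex.cell (Set.univ : Set G.carrier) m → G.carrier :=
    fun e => RelCWComplex.map m e 0
  have hc : ∀ e, c e ∈ RelCWComplex.openCell m e :=
    fun e => RelCWComplex.map_zero_mem_openCell m e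
  have key : ∀ S : Set (RelCWComplex.cell (Set.univ : Set G.carrier) m), IsClosed (c '' S) := by
    intro S
    apply G.isClosed_of_subsingleton_inter
    rintro k e _ ⟨⟨a, -, rfl⟩, ha⟩ _ ⟨⟨b, -, rfl⟩, hb⟩
    have h1 := RelCWComplex.eq_of_not_disjoint_openCell
      (Set.not_disjoint_iff.2 ⟨_, hc a, ha⟩)
    have h2 := RelCWComplex.eq_of_not_disjoint_openCell
      (Set.not_disjoint_iff.2 ⟨_, hc b, hb⟩)
    have h3 := h1.trans h2.symm
    simp only [Sigma.mk.injEq, heq_eq_eq, true_and] at h3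
    rw [h3]
  have hinj : Function.Injective c := by
    intro a b hab
    have h3 := RelCWComplex.eq_of_not_disjoint_openCell
      (Set.not_disjoint_iff.2 ⟨_, hc a, hab ▸ hc b⟩)
    simpa using h3
  have hdisc : IsDiscrete (Set.range c) := by
    constructor
    rw [discreteTopology_iff_forall_isClosed]
    intro T
    have : T = Subtype.val ⁻¹' (c '' (c ⁻¹' (Subtype.val '' T))) := by
      ext ⟨_, a, rfl⟩
      simp [hinj.eq_iff]
    rw [this]
    exact (key _).preimage continuous_subtype_val
  have hfin : (Set.range c).Finite := by
    refine IsCompact.finite ?_ hdisc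
    rw [← Set.image_univ]
    exact (key _).isCompact
  have := hfin.to_subtype
  exact Finite.of_injective (Set.rangeFactorization c)
    (fun a b h => hinj (congrArg Subtype.val h))

instance (G : CWGraph.{u}) : Finite G.V := by delta V; exact G.finite_cell 0

instance (G : CWGraph.{u}) : Finite G.E := by delta E; exact G.finite_cell 1

end CWGraph

/-- Integral singular homology `H_i(X; ℤ)` of a topological space. -/
def integralHomology (X : Type u) [TopologicalSpace X] (i : ℕ) : ModuleCat.{u} ℤ :=
  ((AlgebraicTopology.singularHomologyFunctor (ModuleCat.{u} ℤ) i).obj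
    (ModuleCat.of ℤ (ULift.{u} ℤ))).obj (TopCat.of X)

/-- The Euler characteristic is the well-defined integer `χ`: all integral homology groups are
finitely generated, only finitely many are nonzero, and `χ` is the alternating sum of their
ranks. -/
def HasEulerCharacteristic (X : Type u) [TopologicalSpace X] (χ : ℤ) : Prop :=
  (∀ i, Module.Finite ℤ (integralHomology X i)) ∧
  {i | Nontrivial (integralHomology X i)}.Finite ∧
  ∑ᶠ i : ℕ, (-1 : ℤ) ^ i * (Module.finrank ℤ (integralHomology X i) : ℤ) = χ

end

/-! Puncture the edges one at a time. For a set `F` of edges, let `punctured n F` be the space of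
sink configurations in which no point sits at the midpoint of an edge of `F`, and let f(n, k) be its
Euler characteristic when k edges lie outside `F`. If every edge is punctured, all points can be
pushed away from the midpoints until they reach vertices, where collisions are allowed; the space
retracts onto V^n and f(n, 0) = |V|^n (`hasEulerCharacteristic_punctured_univ`).

To compare `F` with `insert e F`, cover `punctured (n + 1) F` by the open set A, where no point is
at the midpoint of e, and the disjoint open sets B_i, where the i-th point lies inside e strictly
closer to the midpoint than all others. These cover, since two points cannot share a midpoint.
Forgetting the i-th point is a homotopy equivalence from B_i to `punctured n (insert e F)`. On A ∩
B_i that point avoids the midpoint, so there are two such pieces, one for each half of e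
(`hasEulerCharacteristic_nearSet`). Inclusion-exclusion gives f(n+1, k+1) = f(n+1, k) + (n+1) f(n,
k) - 2(n+1) f(n, k), which is the recursion satisfied by the stated sum (`sum_euler_succ`).

The topological input is homotopy invariance and additivity of the Euler characteristic on open
covers (`HasEulerCharacteristic.union_of_isOpen`). Additivity comes from the Mayer-Vietoris sequence
of two simplicial subcomplexes together with the theorem on small simplices
(`quasiIso_smallSimplices`), proved by iterated barycentric subdivision. -/

noncomputable section

/-! ### Ranks of graded modules and long exact sequences -/

section GradedEuler

/-- Total finiteness and the value of the Euler characteristic for a graded module. -/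
def HasGradedEuler (R : Type*) [CommRing R] (M : ℕ → Type u) [∀ i, AddCommGroup (M i)] [∀ i, Module R (M i)] (χ : ℤ) :
    Prop :=
  (∀ i, Module.Finite R (M i)) ∧ {i | Nontrivial (M i)}.Finite ∧
    ∑ᶠ i : ℕ, (-1 : ℤ) ^ i * (Module.finrank R (M i) : ℤ) = χ

variable {R : Type*} [CommRing R] {A B C : ℕ → Type u} [∀ i, AddCommGroup (A i)] [∀ i, Module R (A i)]
  [∀ i, AddCommGroup (B i)] [∀ i, Module R (B i)] [∀ i, AddCommGroup (C i)] [∀ i, Module R (C i)]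

lemma HasGradedEuler.congr {χ : ℤ} (h : HasGradedEuler R A χ) (e : ∀ i, Nonempty (A i ≃ₗ[R] B i)) :
    HasGradedEuler R B χ := by
  obtain ⟨h1, h2, h3⟩ := h
  refine ⟨fun i => ?_, ?_, ?_⟩
  · have := h1 i
    exact Module.Finite.equiv (e i).some
  · convert h2 using 3 with i
    exact (e i).some.toEquiv.nontrivial_congr.symm
  · rw [← h3]
    refine finsum_congr fun i => ?_
    rw [(e i).some.finrank_eq]

lemma HasGradedEuler.exists_bound {χ : ℤ} (h : HasGradedEuler R A χ) :
    ∃ N, ∀ i, N ≤ i → Subsingleton (A i) := by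
  obtain ⟨N, hN⟩ := h.2.1.bddAbove
  refine ⟨N + 1, fun i hi => ?_⟩
  rw [← not_nontrivial_iff_subsingleton]
  intro hn
  have := hN hn
  omega

variable [IsDomain R]

lemma finrank_eq_range_add_ker {M N : Type*} [AddCommGroup M] [Module R M] [AddCommGroup N]
    [Module R N] [Module.Finite R M] (f : M →ₗ[R] N) :
    Module.finrank R M = Module.finrank R (LinearMap.range f) +
      Module.finrank R (LinearMap.ker f) := by
  rw [← Submodule.finrank_quotient_add_finrank (LinearMap.ker f),
    f.quotKerEquivRange.finrank_eq]

lemma finsum_eq_sum_range_of_subsingleton {N : ℕ} (hN : ∀ i, N ≤ i → Subsingleton (A i)) :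
    ∑ᶠ i : ℕ, (-1 : ℤ) ^ i * (Module.finrank R (A i) : ℤ) =
      ∑ i ∈ Finset.range N, (-1 : ℤ) ^ i * (Module.finrank R (A i) : ℤ) := by
  apply finsum_eq_sum_of_support_subset
  intro i hi
  simp only [Finset.coe_range, Set.mem_Iio]
  by_contra hc
  have := hN i (not_lt.1 hc)
  exact hi (by simp [Module.finrank_zero_of_subsingleton])

lemma hasGradedEuler_iff_of_bound {N : ℕ} (hN : ∀ i, N ≤ i → Subsingleton (A i)) (χ : ℤ) :
    HasGradedEuler R A χ ↔ (∀ i, Module.Finite R (A i)) ∧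
      ∑ i ∈ Finset.range N, (-1 : ℤ) ^ i * (Module.finrank R (A i) : ℤ) = χ := by
  rw [HasGradedEuler, finsum_eq_sum_range_of_subsingleton hN]
  refine ⟨fun h => ⟨h.1, h.2.2⟩, fun h => ⟨h.1, ?_, h.2⟩⟩
  refine (Set.finite_lt_nat N).subset fun i hi => ?_
  by_contra hc
  exact not_nontrivial_iff_subsingleton.2 (hN i (not_lt.1 hc)) hi

lemma HasGradedEuler.prod_equiv {a b : ℤ} (hA : HasGradedEuler R A a) (hB : HasGradedEuler R B b)
    (e : ∀ i, Nonempty ((A i × B i) ≃ₗ[R] C i)) : HasGradedEuler R C (a + b) := by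
  suffices HasGradedEuler R (fun i => A i × B i) (a + b) from this.congr e
  obtain ⟨N, hN⟩ := hA.exists_bound
  obtain ⟨M, hM⟩ := hB.exists_bound
  have hA' := (hasGradedEuler_iff_of_bound (N := max N M)
    (fun i hi => hN i (le_trans (le_max_left _ _) hi)) a).1 hA
  have hB' := (hasGradedEuler_iff_of_bound (N := max N M)
    (fun i hi => hM i (le_trans (le_max_right _ _) hi)) b).1 hB
  have := hA'.1
  have := hB'.1
  refine (hasGradedEuler_iff_of_bound (N := max N M) (fun i hi => ?_) _).2
    ⟨fun i => inferInstance, ?_⟩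
  · have := hN i (le_trans (le_max_left _ _) hi)
    have := hM i (le_trans (le_max_right _ _) hi)
    infer_instance
  · rw [← hA'.2, ← hB'.2, ← Finset.sum_add_distrib]
    refine Finset.sum_congr rfl fun i _ => ?_
    have := finrank_eq_range_add_ker (LinearMap.fst R (A i) (B i))
    rw [LinearMap.range_eq_top.2 Prod.fst_surjective, finrank_top, LinearMap.ker_fst,
      LinearMap.finrank_range_of_inj LinearMap.inr_injective] at this
    rw [this]
    push_cast
    ring

/-- Exactness splits the rank of each term into the ranks of the two adjacent images. In the
alternating sum the images of `f` and `g` cancel, and those of the connecting maps telescope. -/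
lemma hasGradedEuler_of_exact [IsNoetherianRing R] {a b : ℤ} (hA : HasGradedEuler R A a) (hB : HasGradedEuler R B b)
    (f : ∀ i, A i →ₗ[R] B i) (g : ∀ i, B i →ₗ[R] C i) (δ : ∀ i, C (i + 1) →ₗ[R] A i)
    (h₂ : ∀ i, Function.Exact (f i) (g i)) (h₃ : ∀ i, Function.Exact (g (i + 1)) (δ i))
    (h₁ : ∀ i, Function.Exact (δ i) (f i)) (h₀ : Function.Surjective (g 0)) :
    HasGradedEuler R C (b - a) := by
  obtain ⟨N, hN⟩ := hA.exists_bound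
  obtain ⟨M, hM⟩ := hB.exists_bound
  set K := max N M with hK
  have hNK : ∀ i, K ≤ i → Subsingleton (A i) := fun i hi => hN i (le_trans (le_max_left _ _) hi)
  have hMK : ∀ i, K ≤ i → Subsingleton (B i) := fun i hi => hM i (le_trans (le_max_right _ _) hi)
  have hA' := (hasGradedEuler_iff_of_bound (N := K + 1) (fun i hi => hNK i (by omega)) a).1 hA
  have hB' := (hasGradedEuler_iff_of_bound (N := K + 1) (fun i hi => hMK i (by omega)) b).1 hB
  have := hA'.1
  have := hB'.1
  -- The bound moves up by one because `C (i + 1)` sits between `B (i + 1)` and `A i`.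
  have hC : ∀ i, K + 1 ≤ i → Subsingleton (C i) := by
    intro i hi
    obtain ⟨i, rfl⟩ : ∃ j, i = j + 1 := ⟨i - 1, by omega⟩
    have := hNK i (by omega)
    have := hMK (i + 1) (by omega)
    refine ⟨fun x y => ?_⟩
    have key : ∀ x : C (i + 1), x = 0 := fun x => by
      obtain ⟨z, rfl⟩ := (h₃ i x).1 (Subsingleton.elim _ _)
      rw [Subsingleton.elim z 0, map_zero]
    rw [key x, key y]
  -- `C (i + 1)` is an extension of a submodule of the Noetherian module `A i` by a quotient of `B
  -- (i + 1)`.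
  have hCf : ∀ i, Module.Finite R (C i) := by
    rintro (_ | i)
    · exact Module.Finite.of_surjective (g 0) h₀
    · have : Module.Finite R (LinearMap.range (δ i)) := inferInstance
      have h4 : Module.Finite R (LinearMap.ker (δ i)) := by
        rw [(LinearMap.exact_iff.1 (h₃ i))]; infer_instance
      rw [Module.finite_def]
      refine Submodule.fg_of_fg_map_of_fg_inf_ker (δ i) ?_ ?_
      · rw [Submodule.map_top]; exact Module.Finite.iff_fg.1 this
      · rw [top_inf_eq]; exact Module.Finite.iff_fg.1 h4
  refine (hasGradedEuler_iff_of_bound hC _).2 ⟨hCf, ?_⟩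
  -- `r i` is the rank of the connecting map leaving `C i`; the value 0 at `i = 0` encodes the
  -- surjectivity of `g 0`.
  set r : ℕ → ℤ := fun i => Nat.casesOn i 0 fun i => (Module.finrank R (LinearMap.range (δ i)) : ℤ)
    with hr
  have e1 : ∀ i, (Module.finrank R (A i) : ℤ) =
      Module.finrank R (LinearMap.range (f i)) + r (i + 1) := fun i => by
    rw [finrank_eq_range_add_ker (f i), LinearMap.exact_iff.1 (h₁ i)]
    simp [hr]
  have e2 : ∀ i, (Module.finrank R (B i) : ℤ) =
      Module.finrank R (LinearMap.range (g i)) + Module.finrank R (LinearMap.range (f i)) :=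
    fun i => by
    rw [finrank_eq_range_add_ker (g i), LinearMap.exact_iff.1 (h₂ i)]
    simp
  have e3 : ∀ i, (Module.finrank R (C i) : ℤ) =
      Module.finrank R (LinearMap.range (g i)) + r i := by
    rintro (_ | i)
    · rw [LinearMap.range_eq_top.2 h₀, finrank_top]; simp [hr]
    · rw [finrank_eq_range_add_ker (δ i), LinearMap.exact_iff.1 (h₃ i)]
      simp [hr, add_comm]
  have tel : ∀ m, ∑ i ∈ Finset.range m, (-1 : ℤ) ^ i * (r i + r (i + 1)) =
      r 0 - (-1) ^ m * r m := by
    intro m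
    induction m with
    | zero => simp
    | succ m ih => rw [Finset.sum_range_succ, ih]; ring
  have r0 : r 0 = 0 := rfl
  have rK : r (K + 1) = 0 := by
    have := hNK K le_rfl
    simp only [hr]
    have : Subsingleton (LinearMap.range (δ K)) := inferInstance
    simp [Module.finrank_zero_of_subsingleton]
  have := tel (K + 1)
  rw [r0, rK] at this
  rw [← hA'.2, ← hB'.2, ← Finset.sum_sub_distrib, ← sub_eq_zero, ← Finset.sum_sub_distrib]
  trans ∑ i ∈ Finset.range (K + 1), (-1 : ℤ) ^ i * (r i + r (i + 1))
  · refine Finset.sum_congr rfl fun i _ => ?_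
    rw [e1, e2, e3]; ring
  · rw [this]; simp

end GradedEuler

/-! ### Euler characteristics of chain complexes -/

section ComplexEuler

open HomologicalComplex

/-- The homology of a chain complex of abelian groups has the Euler characteristic `χ`. -/
def HasHomologyEuler (K : ChainComplex (ModuleCat.{u} ℤ) ℕ) (χ : ℤ) : Prop :=
  HasGradedEuler ℤ (fun i => K.homology i) χ

lemma HasHomologyEuler.of_quasiIso {K L : ChainComplex (ModuleCat.{u} ℤ) ℕ} (φ : K ⟶ L)
    [QuasiIso φ] {χ : ℤ} (h : HasHomologyEuler K χ) : HasHomologyEuler L χ :=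
  HasGradedEuler.congr h fun i => ⟨(asIso (homologyMap φ i)).toLinearEquiv⟩

lemma HasHomologyEuler.of_iso {K L : ChainComplex (ModuleCat.{u} ℤ) ℕ} (e : K ≅ L)
    {χ : ℤ} (h : HasHomologyEuler K χ) : HasHomologyEuler L χ :=
  h.of_quasiIso e.hom

lemma HasHomologyEuler.biprod {K L : ChainComplex (ModuleCat.{u} ℤ) ℕ}
    {a b : ℤ} (hK : HasHomologyEuler K a) (hL : HasHomologyEuler L b) :
    HasHomologyEuler (K ⊞ L) (a + b) := by
  refine HasGradedEuler.prod_equiv hK hL fun i => ?_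
  have := Limits.preservesBinaryBiproducts_of_preservesBiproducts
    (homologyFunctor (ModuleCat.{u} ℤ) (ComplexShape.down ℕ) i)
  have e1 := (homologyFunctor (ModuleCat.{u} ℤ) (ComplexShape.down ℕ) i).mapBiprod K L
  exact ⟨(e1 ≪≫ ModuleCat.biprodIsoProd _ _).symm.toLinearEquiv⟩

/-- In degree 0 every chain is a cycle, so homology equals the opcycles, a quotient of the chains.
This provides the right end of the long exact sequence. -/
lemma surjective_homologyMap_zero {K L : ChainComplex (ModuleCat.{u} ℤ) ℕ} (g : K ⟶ L) [Epi g] :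
    Epi (homologyMap g 0) := by
  have : Epi (opcyclesMap g 0) := by
    have h1 : K.pOpcycles 0 ≫ opcyclesMap g 0 = g.f 0 ≫ L.pOpcycles 0 := by simp
    have h2 : Epi (g.f 0) := inferInstance
    have : Epi (K.pOpcycles 0 ≫ opcyclesMap g 0) := by rw [h1]; infer_instance
    exact epi_of_epi (K.pOpcycles 0) _
  have h5 : homologyMap g 0 = K.homologyι 0 ≫ opcyclesMap g 0 ≫ inv (L.homologyι 0) := by
    rw [← homologyι_naturality_assoc, IsIso.hom_inv_id, Category.comp_id]
  rw [h5]
  infer_instance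

lemma HasHomologyEuler.of_shortExact {S : ShortComplex (ChainComplex (ModuleCat.{u} ℤ) ℕ)}
    (hS : S.ShortExact) {a b : ℤ} (h₁ : HasHomologyEuler S.X₁ a) (h₂ : HasHomologyEuler S.X₂ b) :
    HasHomologyEuler S.X₃ (b - a) := by
  have := hS.epi_g
  refine hasGradedEuler_of_exact h₁ h₂ (fun i => (homologyMap S.f i).hom)
    (fun i => (homologyMap S.g i).hom) (fun i => (hS.δ (i + 1) i rfl).hom) ?_ ?_ ?_ ?_
  · exact fun i => (ShortComplex.ShortExact.moduleCat_exact_iff_function_exact _).1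
      (hS.homology_exact₂ i)
  · exact fun i => (ShortComplex.ShortExact.moduleCat_exact_iff_function_exact _).1
      (hS.homology_exact₃ (i + 1) i rfl)
  · exact fun i => (ShortComplex.ShortExact.moduleCat_exact_iff_function_exact _).1
      (hS.homology_exact₁ (i + 1) i rfl)
  · exact (ModuleCat.epi_iff_surjective _).1 (surjective_homologyMap_zero S.g)

end ComplexEuler

/-! ### Free chains on simplicial sets and Mayer-Vietoris for subcomplexes -/

section

open CategoryTheory.Limits AlgebraicTopology Simplicial Opposite

/-- The free abelian group functor. -/
@[reducible]
def freeZ : Type u ⥤ ModuleCat.{u} ℤ where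
  obj X := ModuleCat.of ℤ (X →₀ ℤ)
  map f := ModuleCat.ofHom (Finsupp.lmapDomain ℤ ℤ f)
  map_id X := by ext1; exact Finsupp.lmapDomain_id ℤ ℤ
  map_comp f g := by ext1; exact Finsupp.lmapDomain_comp ℤ ℤ f g

lemma freeZ_hom_ext {X : Type u} {M : ModuleCat.{u} ℤ} {f g : freeZ.obj X ⟶ M}
    (h : ∀ x : X, f.hom (Finsupp.single x (1 : ℤ)) = g.hom (Finsupp.single x (1 : ℤ))) :
    f = g := by
  ext1
  exact Finsupp.lhom_ext' fun x => LinearMap.ext_ring (h x)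

lemma linearCombination_single_one {R X M : Type*} [Ring R] [AddCommGroup M] [Module R M]
    (v : X → M) (x : X) : Finsupp.linearCombination R v (Finsupp.single x 1) = v x := by
  simp

/-- The free abelian group functor agrees with taking copowers of `ℤ`. -/
def sigmaConstIsoFree :
    (sigmaConst.obj (ModuleCat.of ℤ (ULift.{u} ℤ)) : Type u ⥤ ModuleCat.{u} ℤ) ≅ freeZ :=
  NatIso.ofComponents (fun X =>
    { hom := Sigma.desc fun x => ModuleCat.ofHom
        (Finsupp.lsingle x ∘ₗ (ULift.moduleEquiv (R := ℤ) (M := ℤ)).toLinearMap)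
      inv := ModuleCat.ofHom (Finsupp.linearCombination ℤ fun x : X =>
        (Sigma.ι (fun _ : X => ModuleCat.of ℤ (ULift.{u} ℤ)) x).hom ⟨1⟩)
      hom_inv_id := by
        refine Sigma.hom_ext _ _ fun x => ?_
        ext ⟨r⟩
        simp only [Sigma.ι_desc_assoc, ModuleCat.hom_comp, ModuleCat.hom_ofHom,
          LinearMap.comp_apply, LinearEquiv.coe_coe, Finsupp.lsingle_apply]
        refine (Finsupp.linearCombination_single ..).trans ?_
        refine (LinearMap.map_smul
          (Sigma.ι (fun _ : X => ModuleCat.of ℤ (ULift.{u} ℤ)) x).hom r ⟨1⟩).symm.trans ?_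
        exact congrArg _ (ULift.ext _ _ (mul_one r))
      inv_hom_id := by
        refine freeZ_hom_ext fun x => ?_
        simp only [ModuleCat.hom_comp, ModuleCat.hom_ofHom, LinearMap.comp_apply]
        refine (congrArg _ (linearCombination_single_one _ _)).trans ?_
        rw [← LinearMap.comp_apply, ← ModuleCat.hom_comp, Sigma.ι_desc]
        rfl }) (by
    intro X Y f
    refine Sigma.hom_ext _ _ fun x => ?_
    ext ⟨r⟩
    simp)

/-- The chain complex of free abelian groups on the simplices of a simplicial set. -/
def freeComplex : SSet.{u} ⥤ ChainComplex (ModuleCat.{u} ℤ) ℕ :=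
  (SimplicialObject.whiskering _ _).obj freeZ ⋙ alternatingFaceMapComplex _

def chainComplexIsoFree (S : SSet.{u}) :
    S.chainComplex (ModuleCat.of ℤ (ULift.{u} ℤ)) ≅ freeComplex.obj S :=
  (alternatingFaceMapComplex _).mapIso (Functor.isoWhiskerLeft S sigmaConstIsoFree)

lemma alternatingFaceMapComplex_d_apply (Y : SimplicialObject (ModuleCat.{u} ℤ)) (n : ℕ)
    (y : Y _⦋n + 1⦌) : (((alternatingFaceMapComplex _).obj Y).d (n + 1) n).hom y =
      ∑ i : Fin (n + 2), (-1 : ℤ) ^ (i : ℕ) • (Y.δ i).hom y := by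
  rw [alternatingFaceMapComplex_obj_d, AlternatingFaceMapComplex.objD]
  simp only [ModuleCat.hom_sum, LinearMap.sum_apply]
  rfl

lemma freeComplex_d_single (S : SSet.{u}) (n : ℕ) (x : S _⦋n + 1⦌) :
   ((freeComplex.obj S).d (n + 1) n).hom (Finsupp.single x (1 : ℤ) : S _⦋n + 1⦌ →₀ ℤ) = 
     (∑ i : Fin (n + 2), (-1 : ℤ) ^ (i : ℕ) • Finsupp.single (S.δ i x) (1 : ℤ) : (S _⦋n⦌ →₀ ℤ)) := by
  refine (alternatingFaceMapComplex_d_apply _ n _).trans ?_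
  refine Finset.sum_congr rfl fun i _ => ?_
  congr 1
  exact Finsupp.mapDomain_single

/-- Singular chains are defined with copowers of `ℤ`; finitely supported functions make them
accessible to explicit computation. -/
lemma hasEulerCharacteristic_iff (X : Type u) [TopologicalSpace X] (χ : ℤ) :
    HasEulerCharacteristic X χ ↔
      HasHomologyEuler (freeComplex.obj (TopCat.toSSet.obj (TopCat.of X))) χ := by
  have e := chainComplexIsoFree (TopCat.toSSet.obj (TopCat.of X))
  exact ⟨fun h => HasHomologyEuler.of_iso e h, fun h => HasHomologyEuler.of_iso e.symm h⟩


/-- Exactness of Mayer-Vietoris in the middle: if the two chains cancel, every simplex in the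
support of `a` also occurs in `b`, so `a` comes from the intersection. -/
lemma Finsupp.exists_mapDomain_of_add_eq_zero {D A B X : Type*} {f₁ : D → A} {f₂ : D → B}
    {g₁ : A → X} {g₂ : B → X} (hf₁ : f₁.Injective) (hg₁ : g₁.Injective) (hg₂ : g₂.Injective)
    (hfg : ∀ d, g₁ (f₁ d) = g₂ (f₂ d)) (hD : ∀ a b, g₁ a = g₂ b → ∃ d, f₁ d = a)
    (a : A →₀ ℤ) (b : B →₀ ℤ) (hab : mapDomain g₁ a + mapDomain g₂ b = 0) :
    ∃ x : D →₀ ℤ, mapDomain f₁ x = a ∧ mapDomain f₂ x = -b := by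
  have ha : mapDomain f₁ (a.comapDomain f₁ hf₁.injOn) = a := by
    refine mapDomain_comapDomain f₁ hf₁ a fun s hs => ?_
    have h1 : mapDomain g₁ a (g₁ s) ≠ 0 := by
      rw [mapDomain_apply hg₁]; simpa using hs
    have h2 : mapDomain g₂ b (g₁ s) ≠ 0 := by
      intro h
      have := DFunLike.congr_fun hab (g₁ s)
      rw [Finsupp.add_apply, h, add_zero] at this
      exact h1 this
    by_contra hc
    refine h2 (mapDomain_of_notMem_range _ _ ?_)
    rintro ⟨t, ht⟩
    exact hc (hD s t ht.symm)
  refine ⟨_, ha, mapDomain_injective hg₂ ?_⟩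
  rw [← mapDomain_comp, show g₂ ∘ f₂ = g₁ ∘ f₁ from funext fun d => (hfg d).symm, mapDomain_comp,
    ha]
  have : mapDomain g₂ (-b) = -mapDomain g₂ b := map_neg (mapDomain.addMonoidHom g₂) b
  rw [this]
  exact eq_neg_of_add_eq_zero_left hab

/-- The hypothesis says that each relative cycle is a boundary modulo the image of `φ`. Hence the
cokernel is acyclic, and the long exact sequence makes `φ` an isomorphism on homology. -/
lemma HomologicalComplex.quasiIso_of_exists_sub_mem_range {K L : ChainComplex (ModuleCat.{u} ℤ) ℕ}
    (φ : K ⟶ L) [Mono φ]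
    (h : ∀ (n : ℕ) (z : L.X n), (∀ m, (L.d n m).hom z ∈ LinearMap.range (φ.f m).hom) →
      ∃ w : L.X (n + 1), z - (L.d (n + 1) n).hom w ∈ LinearMap.range (φ.f n).hom) :
    QuasiIso φ := by
  let S := ShortComplex.mk φ (cokernel.π φ) (cokernel.condition φ)
  have hS : S.ShortExact := { exact := ShortComplex.exact_cokernel φ }
  have hdeg : ∀ n, Function.Exact (φ.f n).hom ((cokernel.π φ).f n).hom := fun n =>
    (ShortComplex.ShortExact.moduleCat_exact_iff_function_exact _).1
      (hS.exact.map (eval (ModuleCat.{u} ℤ) (ComplexShape.down ℕ) n))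
  have hQ : ∀ n, (cokernel φ).ExactAt n := by
    intro n
    rw [exactAt_iff' _ (n + 1) n ((ComplexShape.down ℕ).next n) (by simp) rfl,
      ShortComplex.moduleCat_exact_iff]
    intro q hq
    obtain ⟨z, rfl⟩ := (ModuleCat.epi_iff_surjective ((cokernel.π φ).f n)).1 inferInstance q
    -- A differential that does not lower the degree by one is zero; this includes every
    -- differential out of degree 0.
    obtain ⟨w, hw⟩ := h n z fun m => by
      by_cases hm : (ComplexShape.down ℕ).Rel n m
      · obtain rfl := (ComplexShape.down ℕ).next_eq' hm
        refine (hdeg _ _).1 ?_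
        rw [← LinearMap.comp_apply, ← ModuleCat.hom_comp, ← Hom.comm, ModuleCat.hom_comp]
        exact hq
      · rw [L.shape _ _ hm]; simp
    refine ⟨((cokernel.π φ).f (n + 1)).hom w, ?_⟩
    have h1 := (hdeg n _).2 hw
    rw [map_sub, sub_eq_zero] at h1
    refine Eq.trans ?_ h1.symm
    change (((cokernel.π φ).f (n + 1)) ≫ (cokernel φ).d (n + 1) n).hom w = _
    rw [Hom.comm]; rfl
  refine ⟨fun n => ?_⟩
  rw [quasiIsoAt_iff_isIso_homologyMap]
  have m1 : Mono (homologyMap φ n) :=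
    (hS.homology_exact₁ (n + 1) n rfl).mono_g ((hQ (n + 1)).isZero_homology.eq_of_src _ _)
  have m2 : Epi (homologyMap φ n) :=
    (hS.homology_exact₂ n).epi_f ((hQ n).isZero_homology.eq_of_tgt _ _)
  exact isIso_of_mono_of_epi _

lemma freeComplex_map_injective {S T : SSet.{u}} (f : S ⟶ T) (hf : ∀ n, Function.Injective (f.app n))
    (n : ℕ) : Function.Injective ((freeComplex.map f).f n).hom :=
  Finsupp.mapDomain_injective (hf _)

/-- The Mayer-Vietoris sequence of two subcomplexes of a simplicial set. -/
@[reducible]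
def mayerVietorisSequence {S : SSet.{u}} (P Q : S.Subcomplex) :
    ShortComplex (ChainComplex (ModuleCat.{u} ℤ) ℕ) :=
  ShortComplex.mk
    (biprod.lift (freeComplex.map (SSet.Subcomplex.homOfLE (inf_le_left : P ⊓ Q ≤ P)))
      (-freeComplex.map (SSet.Subcomplex.homOfLE (inf_le_right : P ⊓ Q ≤ Q))))
    (biprod.desc (freeComplex.map (SSet.Subcomplex.homOfLE (le_sup_left : P ≤ P ⊔ Q)))
      (freeComplex.map (SSet.Subcomplex.homOfLE (le_sup_right : Q ≤ P ⊔ Q)))) (by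
    rw [biprod.lift_desc, Preadditive.neg_comp, ← Functor.map_comp, ← Functor.map_comp,
      SSet.Subcomplex.homOfLE_comp, SSet.Subcomplex.homOfLE_comp, add_neg_cancel])

/-- Everything is checked on basis simplices: a simplex of `P ⊔ Q` lies in `P` or in `Q`, and one
coming from both lies in `P ⊓ Q`. -/
lemma mayerVietorisSequence_shortExact {S : SSet.{u}} (P Q : S.Subcomplex) :
    (mayerVietorisSequence P Q).ShortExact := by
  have hi : ∀ (A B : S.Subcomplex) (h : A ≤ B) (n), Function.Injective
      ((freeComplex.map (SSet.Subcomplex.homOfLE h)).f n).hom := fun A B h n =>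
    freeComplex_map_injective _ (fun m => Set.inclusion_injective (h m)) n
  refine HomologicalComplex.shortExact_of_degreewise_shortExact _ fun n => ?_
  set i₁ := (freeComplex.map (SSet.Subcomplex.homOfLE (inf_le_left : P ⊓ Q ≤ P))).f n with hi₁
  set i₂ := (freeComplex.map (SSet.Subcomplex.homOfLE (inf_le_right : P ⊓ Q ≤ Q))).f n with hi₂
  set j₁ := (freeComplex.map (SSet.Subcomplex.homOfLE (le_sup_left : P ≤ P ⊔ Q))).f n with hj₁
  set j₂ := (freeComplex.map (SSet.Subcomplex.homOfLE (le_sup_right : Q ≤ P ⊔ Q))).f n with hj₂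
  have e1 : (mayerVietorisSequence P Q).f.f n ≫ (biprod.fst : _ ⟶ freeComplex.obj P.toSSet).f n = i₁ :=
    HomologicalComplex.biprod_lift_fst_f ..
  have e2 : (mayerVietorisSequence P Q).f.f n ≫ (biprod.snd : _ ⟶ freeComplex.obj Q.toSSet).f n = -i₂ :=
    HomologicalComplex.biprod_lift_snd_f ..
  have e3 : (biprod.inl : freeComplex.obj P.toSSet ⟶ _).f n ≫ (mayerVietorisSequence P Q).g.f n = j₁ :=
    HomologicalComplex.biprod_inl_desc_f ..
  have e4 : (biprod.inr : freeComplex.obj Q.toSSet ⟶ _).f n ≫ (mayerVietorisSequence P Q).g.f n = j₂ :=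
    HomologicalComplex.biprod_inr_desc_f ..
  have tot : ∀ y, ((biprod.inl : freeComplex.obj P.toSSet ⟶ _).f n).hom
      (((biprod.fst : _ ⟶ freeComplex.obj P.toSSet).f n).hom y) +
      ((biprod.inr : freeComplex.obj Q.toSSet ⟶ _).f n).hom
      (((biprod.snd : _ ⟶ freeComplex.obj Q.toSSet).f n).hom y) = y := fun y => by
    have := HomologicalComplex.biprod_total_f (freeComplex.obj P.toSSet) (freeComplex.obj Q.toSSet) n
    exact congrArg (fun φ => φ.hom y) this
  refine { exact := ?_, mono_f := ?_, epi_g := ?_ }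
  · rw [ShortComplex.moduleCat_exact_iff]
    intro y hy
    replace hy : ((mayerVietorisSequence P Q).g.f n).hom y = 0 := hy
    rw [← tot y, map_add] at hy
    obtain ⟨x, hx1, hx2⟩ := Finsupp.exists_mapDomain_of_add_eq_zero
      (f₁ := (SSet.Subcomplex.homOfLE (inf_le_left : P ⊓ Q ≤ P)).app (op ⦋n⦌))
      (f₂ := (SSet.Subcomplex.homOfLE (inf_le_right : P ⊓ Q ≤ Q)).app (op ⦋n⦌))
      (g₁ := (SSet.Subcomplex.homOfLE (le_sup_left : P ≤ P ⊔ Q)).app (op ⦋n⦌))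
      (g₂ := (SSet.Subcomplex.homOfLE (le_sup_right : Q ≤ P ⊔ Q)).app (op ⦋n⦌))
      (Set.inclusion_injective ((inf_le_left : P ⊓ Q ≤ P) _))
      (Set.inclusion_injective ((le_sup_left : P ≤ P ⊔ Q) _))
      (Set.inclusion_injective ((le_sup_right : Q ≤ P ⊔ Q) _)) (fun _ => rfl)
      (fun a b hab => ⟨⟨a.1, a.2, by
        have : a.1 = b.1 := congrArg Subtype.val hab
        rw [this]; exact b.2⟩, rfl⟩)
      (((biprod.fst : _ ⟶ freeComplex.obj P.toSSet).f n).hom y)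
      (((biprod.snd : _ ⟶ freeComplex.obj Q.toSSet).f n).hom y) (by
        refine Eq.trans ?_ hy
        refine congrArg₂ (· + ·) (LinearMap.congr_fun (congrArg ModuleCat.Hom.hom e3.symm) _)
          (LinearMap.congr_fun (congrArg ModuleCat.Hom.hom e4.symm) _))
    refine ⟨x, ?_⟩
    refine (tot _).symm.trans (Eq.trans ?_ (tot y))
    refine congrArg₂ (· + ·) (congrArg _ ?_) (congrArg _ ?_)
    · exact (congrArg (fun φ => φ.hom x) e1).trans hx1
    · refine (congrArg (fun φ => φ.hom x) e2).trans ?_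
      exact (congrArg Neg.neg hx2).trans (neg_neg _)
  · have : Mono ((mayerVietorisSequence P Q).f.f n ≫
        (biprod.fst : _ ⟶ freeComplex.obj P.toSSet).f n) := by
      rw [e1, ModuleCat.mono_iff_injective]; exact hi _ _ _ n
    exact @mono_of_mono _ _ _ _ _ _ _ this
  · refine (ModuleCat.epi_iff_range_eq_top _).2 (eq_top_iff.2 fun z _ => ?_)
    change (z : (P ⊔ Q : S.Subcomplex).toSSet _⦋n⦌ →₀ ℤ) ∈
      LinearMap.range ((mayerVietorisSequence P Q).g.f n).hom
    have h1 : ∀ y, j₁.hom y ∈ LinearMap.range ((mayerVietorisSequence P Q).g.f n).hom := fun y =>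
      ⟨_, LinearMap.congr_fun (congrArg ModuleCat.Hom.hom e3) y⟩
    have h2 : ∀ y, j₂.hom y ∈ LinearMap.range ((mayerVietorisSequence P Q).g.f n).hom := fun y =>
      ⟨_, LinearMap.congr_fun (congrArg ModuleCat.Hom.hom e4) y⟩
    induction z using Finsupp.induction_linear with
    | zero => exact Submodule.zero_mem _
    | add a b ha hb => exact Submodule.add_mem _ (ha trivial) (hb trivial)
    | single s r =>
      obtain ⟨s, hs | hs⟩ := s
      · have e : j₁.hom (Finsupp.single (⟨s, hs⟩ : P.toSSet _⦋n⦌) r : P.toSSet _⦋n⦌ →₀ ℤ) =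
            (Finsupp.single ⟨s, Or.inl hs⟩ r : (P ⊔ Q : S.Subcomplex).toSSet _⦋n⦌ →₀ ℤ) :=
          Finsupp.mapDomain_single
        exact e ▸ h1 _
      · have e : j₂.hom (Finsupp.single (⟨s, hs⟩ : Q.toSSet _⦋n⦌) r : Q.toSSet _⦋n⦌ →₀ ℤ) =
            (Finsupp.single ⟨s, Or.inr hs⟩ r : (P ⊔ Q : S.Subcomplex).toSSet _⦋n⦌ →₀ ℤ) :=
          Finsupp.mapDomain_single
        exact e ▸ h2 _

lemma HasHomologyEuler.sup {S : SSet.{u}} {P Q : S.Subcomplex} {a b c : ℤ}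
    (hP : HasHomologyEuler (freeComplex.obj P.toSSet) a)
    (hQ : HasHomologyEuler (freeComplex.obj Q.toSSet) b)
    (hPQ : HasHomologyEuler (freeComplex.obj (P ⊓ Q : S.Subcomplex).toSSet) c) :
    HasHomologyEuler (freeComplex.obj (P ⊔ Q : S.Subcomplex).toSSet) (a + b - c) :=
  HasHomologyEuler.of_shortExact (mayerVietorisSequence_shortExact P Q) hPQ (hP.biprod hQ)

end

/-! ### Barycentric subdivision of chains of tuples -/

section LinearChains

variable {P P' : Type*}

/-- The boundary of a chain of ordered tuples (augmented by the empty tuple). -/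
def tupleBoundary (P : Type*) (k : ℕ) : ((Fin (k + 1) → P) →₀ ℤ) →ₗ[ℤ] ((Fin k → P) →₀ ℤ) :=
  Finsupp.linearCombination ℤ fun q =>
    ∑ i : Fin (k + 1), (-1 : ℤ) ^ (i : ℕ) • Finsupp.single (q ∘ i.succAbove) (1 : ℤ)

/-- The cone with apex `b` on a chain of tuples. -/
def tupleCone (b : P) (k : ℕ) : ((Fin k → P) →₀ ℤ) →ₗ[ℤ] ((Fin (k + 1) → P) →₀ ℤ) :=
  Finsupp.lmapDomain ℤ ℤ fun q => Fin.cons b q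

/-- The map induced on chains of tuples by a map of points. -/
def tupleMap (f : P → P') (k : ℕ) : ((Fin k → P) →₀ ℤ) →ₗ[ℤ] ((Fin k → P') →₀ ℤ) :=
  Finsupp.lmapDomain ℤ ℤ fun q => f ∘ q

lemma tupleBoundary_single (k : ℕ) (q : Fin (k + 1) → P) :
    tupleBoundary P k (Finsupp.single q 1) =
      ∑ i : Fin (k + 1), (-1 : ℤ) ^ (i : ℕ) • Finsupp.single (q ∘ i.succAbove) (1 : ℤ) :=
  linearCombination_single_one _ _

lemma tupleCone_single (b : P) (k : ℕ) (q : Fin k → P) (r : ℤ) :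
    tupleCone b k (Finsupp.single q r) = Finsupp.single (Fin.cons b q) r :=
  Finsupp.mapDomain_single

lemma tupleMap_single (f : P → P') (k : ℕ) (q : Fin k → P) (r : ℤ) :
    tupleMap f k (Finsupp.single q r) = Finsupp.single (f ∘ q) r :=
  Finsupp.mapDomain_single

lemma tuple_hom_ext {k : ℕ} {M : Type*} [AddCommGroup M] [Module ℤ M]
    {f g : ((Fin k → P) →₀ ℤ) →ₗ[ℤ] M}
    (h : ∀ q, f (Finsupp.single q 1) = g (Finsupp.single q 1)) : f = g :=
  Finsupp.lhom_ext' fun x => LinearMap.ext_ring (h x)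

lemma tupleBoundary_cone_zero (b : P) (c : (Fin 0 → P) →₀ ℤ) :
    tupleBoundary P 0 (tupleCone b 0 c) = c := by
  suffices (tupleBoundary P 0) ∘ₗ (tupleCone b 0) = LinearMap.id from LinearMap.congr_fun this c
  refine tuple_hom_ext fun q => ?_
  simp only [LinearMap.comp_apply, tupleCone_single, tupleBoundary_single, LinearMap.id_apply]
  simp [Subsingleton.elim _ q]

/-- Omitting the apex gives back `c`; omitting any other entry gives a cone on a face of `c`, with
the index, hence the sign, shifted by one. -/
lemma tupleBoundary_cone_succ (b : P) (k : ℕ) (c : (Fin (k + 1) → P) →₀ ℤ) :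
    tupleBoundary P (k + 1) (tupleCone b (k + 1) c) = c - tupleCone b k (tupleBoundary P k c) := by
  suffices (tupleBoundary P (k + 1)) ∘ₗ (tupleCone b (k + 1)) =
    LinearMap.id - (tupleCone b k) ∘ₗ (tupleBoundary P k) from LinearMap.congr_fun this c
  refine tuple_hom_ext fun q => ?_
  simp only [LinearMap.comp_apply, tupleCone_single, tupleBoundary_single, LinearMap.id_apply,
    LinearMap.sub_apply, map_sum, map_zsmul]
  rw [Fin.sum_univ_succ, sub_eq_add_neg, ← Finset.sum_neg_distrib]
  congr 1
  · simp only [Fin.val_zero, pow_zero, one_smul]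
    congr 1
  · refine Finset.sum_congr rfl fun i _ => ?_
    rw [Fin.val_succ, pow_succ, mul_neg_one, neg_smul]
    congr 3
    funext j
    refine Fin.cases ?_ (fun j => ?_) j
    · simp
    · simp

/-- Each nonempty tuple is the cone on its tail, so the cone formula gives the claim by induction
and no double sum is needed. -/
lemma tupleBoundary_tupleBoundary (k : ℕ) (c : (Fin (k + 2) → P) →₀ ℤ) :
    tupleBoundary P k (tupleBoundary P (k + 1) c) = 0 := by
  suffices (tupleBoundary P k) ∘ₗ (tupleBoundary P (k + 1)) = 0 from LinearMap.congr_fun this c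
  clear c
  induction k with
  | zero =>
    refine tuple_hom_ext fun q => ?_
    obtain ⟨b, q, rfl⟩ : ∃ b q', q = Fin.cons b q' := ⟨_, _, (Fin.cons_self_tail q).symm⟩
    rw [← tupleCone_single, LinearMap.comp_apply, tupleBoundary_cone_succ, map_sub,
      tupleBoundary_cone_zero, sub_self, LinearMap.zero_apply]
  | succ k ih =>
    refine tuple_hom_ext fun q => ?_
    obtain ⟨b, q, rfl⟩ : ∃ b q', q = Fin.cons b q' := ⟨_, _, (Fin.cons_self_tail q).symm⟩
    rw [← tupleCone_single, LinearMap.comp_apply, tupleBoundary_cone_succ, map_sub,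
      tupleBoundary_cone_succ, ← LinearMap.comp_apply (tupleBoundary P k), ih]
    simp

lemma tupleMap_boundary (f : P → P') (k : ℕ) (c : (Fin (k + 1) → P) →₀ ℤ) :
    tupleMap f k (tupleBoundary P k c) = tupleBoundary P' k (tupleMap f (k + 1) c) := by
  suffices (tupleMap f k) ∘ₗ (tupleBoundary P k) = (tupleBoundary P' k) ∘ₗ (tupleMap f (k + 1))
    from LinearMap.congr_fun this c
  refine tuple_hom_ext fun q => ?_
  simp only [LinearMap.comp_apply, tupleMap_single, tupleBoundary_single, map_sum, map_zsmul]
  rfl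

lemma tupleMap_cone (f : P → P') (b : P) (k : ℕ) (c : (Fin k → P) →₀ ℤ) :
    tupleMap f (k + 1) (tupleCone b k c) = tupleCone (f b) k (tupleMap f k c) := by
  suffices (tupleMap f (k + 1)) ∘ₗ (tupleCone b k) = (tupleCone (f b) k) ∘ₗ (tupleMap f k)
    from LinearMap.congr_fun this c
  refine tuple_hom_ext fun q => ?_
  simp only [LinearMap.comp_apply, tupleMap_single, tupleCone_single]
  congr 1
  funext j
  refine Fin.cases ?_ (fun j => ?_) j <;> simp

variable (bary : ∀ k : ℕ, (Fin (k + 1) → P) → P) (bary' : ∀ k : ℕ, (Fin (k + 1) → P') → P')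

/-- Barycentric subdivision of chains of tuples, for a choice of barycenters. -/
def tupleSubdivision : ∀ k : ℕ, ((Fin k → P) →₀ ℤ) →ₗ[ℤ] ((Fin k → P) →₀ ℤ)
  | 0 => LinearMap.id
  | k + 1 => Finsupp.linearCombination ℤ fun q =>
      tupleCone (bary k q) k (tupleSubdivision k (tupleBoundary P k (Finsupp.single q 1)))

/-- The chain homotopy between barycentric subdivision and the identity. -/
def tupleHomotopy : ∀ k : ℕ, ((Fin k → P) →₀ ℤ) →ₗ[ℤ] ((Fin (k + 1) → P) →₀ ℤ)
  | 0 => 0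
  | k + 1 => Finsupp.linearCombination ℤ fun q =>
      tupleCone (bary k q) (k + 1) (Finsupp.single q 1 -
        tupleHomotopy k (tupleBoundary P k (Finsupp.single q 1)))

lemma tupleSubdivision_succ_single (k : ℕ) (q : Fin (k + 1) → P) :
    tupleSubdivision bary (k + 1) (Finsupp.single q 1) =
      tupleCone (bary k q) k (tupleSubdivision bary k (tupleBoundary P k (Finsupp.single q 1))) :=
  linearCombination_single_one _ _

lemma tupleHomotopy_succ_single (k : ℕ) (q : Fin (k + 1) → P) :
    tupleHomotopy bary (k + 1) (Finsupp.single q 1) =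
      tupleCone (bary k q) (k + 1) (Finsupp.single q 1 -
        tupleHomotopy bary k (tupleBoundary P k (Finsupp.single q 1))) :=
  linearCombination_single_one _ _

/-- Purely formal, for any choice of barycenters. Write S, T for subdivision and homotopy and b for
the apex of q. The cone formula gives ∂Tq = q - T∂q - b·∂(q - T∂q), and by induction with ∂² = 0,
∂(q - T∂q) = S∂q, whose cone is Sq. -/
lemma tupleBoundary_homotopy (k : ℕ) (c : (Fin (k + 1) → P) →₀ ℤ) :
    tupleBoundary P (k + 1) (tupleHomotopy bary (k + 1) c) =
      c - tupleSubdivision bary (k + 1) c - tupleHomotopy bary k (tupleBoundary P k c) := by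
  suffices (tupleBoundary P (k + 1)) ∘ₗ (tupleHomotopy bary (k + 1)) =
    LinearMap.id - tupleSubdivision bary (k + 1) - (tupleHomotopy bary k) ∘ₗ (tupleBoundary P k)
    from LinearMap.congr_fun this c
  clear c
  induction k with
  | zero =>
    refine tuple_hom_ext fun q => ?_
    simp only [LinearMap.comp_apply, LinearMap.sub_apply, LinearMap.id_apply,
      tupleHomotopy_succ_single, tupleBoundary_cone_succ, tupleSubdivision_succ_single]
    simp [tupleHomotopy, tupleSubdivision]
  | succ k ih =>
    refine tuple_hom_ext fun q => ?_
    have h := LinearMap.congr_fun ih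
      (tupleBoundary P (k + 1) (Finsupp.single q 1))
    simp only [LinearMap.comp_apply, LinearMap.sub_apply, LinearMap.id_apply,
      tupleBoundary_tupleBoundary, map_zero, sub_zero] at h
    simp only [LinearMap.comp_apply, LinearMap.sub_apply, LinearMap.id_apply,
      tupleHomotopy_succ_single bary (k + 1), tupleBoundary_cone_succ,
      tupleSubdivision_succ_single bary (k + 1), map_sub, h]
    abel

variable {bary bary'}

lemma tupleMap_subdivision {f : P → P'} (hf : ∀ k q, f (bary k q) = bary' k (f ∘ q)) (k : ℕ) (c : (Fin k → P) →₀ ℤ) :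
    tupleMap f k (tupleSubdivision bary k c) = tupleSubdivision bary' k (tupleMap f k c) := by
  suffices (tupleMap f k) ∘ₗ (tupleSubdivision bary k) = (tupleSubdivision bary' k) ∘ₗ (tupleMap f k)
    from LinearMap.congr_fun this c
  clear c
  induction k with
  | zero => rfl
  | succ k ih =>
    refine tuple_hom_ext fun q => ?_
    simp only [LinearMap.comp_apply, tupleMap_single, tupleSubdivision_succ_single, tupleMap_cone,
      hf]
    rw [← LinearMap.comp_apply (tupleMap f k), ih, LinearMap.comp_apply, tupleMap_boundary,
      tupleMap_single]

lemma tupleMap_homotopy {f : P → P'} (hf : ∀ k q, f (bary k q) = bary' k (f ∘ q)) (k : ℕ) (c : (Fin k → P) →₀ ℤ) :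
    tupleMap f (k + 1) (tupleHomotopy bary k c) = tupleHomotopy bary' k (tupleMap f k c) := by
  suffices (tupleMap f (k + 1)) ∘ₗ (tupleHomotopy bary k) = (tupleHomotopy bary' k) ∘ₗ (tupleMap f k)
    from LinearMap.congr_fun this c
  clear c
  induction k with
  | zero => ext; simp [tupleHomotopy]
  | succ k ih =>
    refine tuple_hom_ext fun q => ?_
    simp only [LinearMap.comp_apply, tupleMap_single, tupleHomotopy_succ_single, tupleMap_cone,
      hf, map_sub]
    rw [← LinearMap.comp_apply (tupleMap f (k + 1)), ih, LinearMap.comp_apply, tupleMap_boundary,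
      tupleMap_single]

end LinearChains

/-! ### Affine simplices and the mesh of a subdivision -/

section

open CategoryTheory.Limits AlgebraicTopology Simplicial Opposite

section AffineSimplices

variable {ι κ η : Type*} [Fintype ι] [Fintype κ] [Fintype η]

/-- The affine map of simplices with prescribed values on the vertices. -/
def affineTuple (q : ι → stdSimplex ℝ κ) (t : stdSimplex ℝ ι) : stdSimplex ℝ κ :=
  ⟨fun k => ∑ i, t i * q i k, fun k => Finset.sum_nonneg fun i _ =>
    mul_nonneg (stdSimplex.zero_le t i) (stdSimplex.zero_le (q i) k), by
    rw [Finset.sum_comm]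
    simp [← Finset.mul_sum]⟩

lemma affineTuple_apply (q : ι → stdSimplex ℝ κ) (t : stdSimplex ℝ ι) (k : κ) :
    affineTuple q t k = ∑ i, t i * q i k := rfl

lemma affineTuple_affineTuple (q : ι → stdSimplex ℝ κ) (p : η → stdSimplex ℝ ι)
    (t : stdSimplex ℝ η) : affineTuple q (affineTuple p t) = affineTuple (affineTuple q ∘ p) t := by
  ext k
  simp only [affineTuple_apply, Finset.sum_mul, Function.comp_apply, Finset.mul_sum]
  rw [Finset.sum_comm]
  simp only [mul_assoc]

lemma affineTuple_vertex [DecidableEq ι] (q : ι → stdSimplex ℝ κ) (i : ι) :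
    affineTuple q (stdSimplex.vertex i) = q i := by
  ext k
  simp [affineTuple_apply, Pi.single_apply]

lemma affineTuple_vertex_self [DecidableEq ι] (t : stdSimplex ℝ ι) :
    affineTuple (stdSimplex.vertex : ι → stdSimplex ℝ ι) t = t := by
  ext k
  simp [affineTuple_apply, Pi.single_apply]

lemma stdSimplex_map_eq_affineTuple [DecidableEq κ] (f : ι → κ) (t : stdSimplex ℝ ι) :
    stdSimplex.map f t = affineTuple (fun i => stdSimplex.vertex (f i)) t := by
  ext k
  simp [affineTuple_apply, Pi.single_apply, FunOnFinite.linearMap_apply_apply, Finset.sum_filter, eq_comm]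

lemma continuous_affineTuple (q : ι → stdSimplex ℝ κ) : Continuous (affineTuple q) := by
  refine Continuous.subtype_mk (continuous_pi fun k => ?_) _
  refine continuous_finsetSum _ fun i _ => Continuous.mul ?_ continuous_const
  exact (continuous_apply i).comp continuous_subtype_val

/-- `affineTuple` as a bundled continuous map. -/
def affineTupleMap (q : ι → stdSimplex ℝ κ) : C(stdSimplex ℝ ι, stdSimplex ℝ κ) :=
  ⟨affineTuple q, continuous_affineTuple q⟩

lemma dist_affineTuple_le_sum (q : ι → stdSimplex ℝ κ) (t : stdSimplex ℝ ι)
    (x : stdSimplex ℝ κ) : dist (affineTuple q t) x ≤ ∑ i, t i * dist (q i) x := by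
  rw [Subtype.dist_eq, dist_pi_le_iff (Finset.sum_nonneg fun i _ =>
    mul_nonneg (stdSimplex.zero_le t i) dist_nonneg)]
  intro k
  have h1 : (affineTuple q t).1 k - x.1 k = ∑ i, t i * ((q i).1 k - x.1 k) := by
    simp only [mul_sub, Finset.sum_sub_distrib, ← Finset.sum_mul, stdSimplex.sum_eq_one, one_mul]
    rfl
  rw [Real.dist_eq, h1]
  refine (Finset.abs_sum_le_sum_abs _ _).trans (Finset.sum_le_sum fun i _ => ?_)
  rw [abs_mul, abs_of_nonneg (stdSimplex.zero_le t i)]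
  refine mul_le_mul_of_nonneg_left ?_ (stdSimplex.zero_le t i)
  rw [← Real.dist_eq, Subtype.dist_eq]
  exact dist_le_pi_dist _ _ k

lemma dist_affineTuple_le (q : ι → stdSimplex ℝ κ) (t : stdSimplex ℝ ι) (x : stdSimplex ℝ κ)
    {r : ℝ} (h : ∀ i, dist (q i) x ≤ r) : dist (affineTuple q t) x ≤ r := by
  refine (dist_affineTuple_le_sum q t x).trans ?_
  refine (Finset.sum_le_sum fun i _ =>
    mul_le_mul_of_nonneg_left (h i) (stdSimplex.zero_le t i)).trans ?_
  rw [← Finset.sum_mul, stdSimplex.sum_eq_one, one_mul]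

/-- The barycenter of a tuple of points. -/
def tupleBarycenter (κ : Type*) [Fintype κ] (k : ℕ) (q : Fin (k + 1) → stdSimplex ℝ κ) :
    stdSimplex ℝ κ :=
  affineTuple q stdSimplex.barycenter

/-- The barycenter is an average of `k + 1` points, one of which is `q j` itself and contributes
distance 0. -/
lemma dist_tupleBarycenter_le (k : ℕ) (q : Fin (k + 1) → stdSimplex ℝ κ) {r : ℝ}
    (h : ∀ i j, dist (q i) (q j) ≤ r) (j : Fin (k + 1)) :
    dist (tupleBarycenter κ k q) (q j) ≤ k / (k + 1) * r := by
  refine (dist_affineTuple_le_sum q _ _).trans ?_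
  have h1 : ∀ i, (stdSimplex.barycenter : stdSimplex ℝ (Fin (k + 1))) i = ((k : ℝ) + 1)⁻¹ :=
    fun i => (stdSimplex.barycenter_apply i).trans (by simp)
  simp only [h1]
  rw [← Finset.mul_sum, div_eq_inv_mul, mul_assoc]
  refine mul_le_mul_of_nonneg_left ?_ (by positivity)
  rw [Fin.sum_univ_succAbove _ j, dist_self, zero_add]
  refine (Finset.sum_le_sum fun i _ => h _ _).trans ?_
  simp

lemma affineTuple_tupleBarycenter (p : ι → stdSimplex ℝ κ) (k : ℕ)
    (q : Fin (k + 1) → stdSimplex ℝ ι) :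
    affineTuple p (tupleBarycenter ι k q) = tupleBarycenter κ k (affineTuple p ∘ q) :=
  affineTuple_affineTuple ..

lemma Finsupp.map_mem_of_mem_supported {α R M : Type*} [Ring R] [AddCommGroup M] [Module R M]
    {A : Set α} (f : (α →₀ R) →ₗ[R] M) (S : Submodule R M)
    (h : ∀ a ∈ A, f (Finsupp.single a 1) ∈ S) {c : α →₀ R} (hc : c ∈ Finsupp.supported R R A) :
    f c ∈ S := by
  rw [Finsupp.supported_eq_span_single] at hc
  have : Submodule.span R ((fun i => Finsupp.single i (1 : R)) '' A) ≤ S.comap f :=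
    Submodule.span_le.2 (by rintro _ ⟨a, ha, rfl⟩; exact h a ha)
  exact this hc

/-- The induction carries a second property: subdivided vertices stay in every closed ball
containing the original ones. Applied to the ball around the barycenter, it bounds the new edges at
the apex. The ratio is stated for a fixed `N` because k/(k+1) increases with k, so all faces share
one bound. -/
lemma tupleSubdivision_mem_supported (N : ℕ) {r : ℝ} (hr : 0 ≤ r) (k : ℕ) (hk : k ≤ N + 1)
    (q : Fin k → stdSimplex ℝ κ) (hq : ∀ i j, dist (q i) (q j) ≤ r) :
    tupleSubdivision (tupleBarycenter κ) k (Finsupp.single q 1) ∈ Finsupp.supported ℤ ℤ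
      {s | (∀ i j, dist (s i) (s j) ≤ N / (N + 1) * r) ∧
        ∀ x R, (∀ j, dist (q j) x ≤ R) → ∀ i, dist (s i) x ≤ R} := by
  induction k with
  | zero =>
    rw [tupleSubdivision]
    exact Finsupp.single_mem_supported _ _ ⟨fun i => i.elim0, fun _ _ _ i => i.elim0⟩
  | succ k ih =>
    rw [tupleSubdivision_succ_single]
    have h1 : tupleSubdivision (tupleBarycenter κ) k (tupleBoundary _ k (Finsupp.single q 1)) ∈
        Finsupp.supported ℤ ℤ {s | (∀ i j, dist (s i) (s j) ≤ N / (N + 1) * r) ∧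
          ∀ x R, (∀ j, dist (q j) x ≤ R) → ∀ i, dist (s i) x ≤ R} := by
      rw [tupleBoundary_single, map_sum]
      refine Submodule.sum_mem _ fun i _ => ?_
      rw [map_zsmul]
      refine Submodule.smul_mem _ _ (Finsupp.supported_mono ?_
        (ih (by omega) (q ∘ i.succAbove) fun _ _ => hq _ _))
      exact fun s hs => ⟨hs.1, fun x R hx => hs.2 x R fun j => hx _⟩
    refine Finsupp.map_mem_of_mem_supported (tupleCone _ k) _ (fun s hs => ?_) h1
    rw [tupleCone_single]
    refine Finsupp.single_mem_supported _ _ ?_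
    have hle : (k : ℝ) / (k + 1) * r ≤ N / (N + 1) * r := by
      refine mul_le_mul_of_nonneg_right ?_ hr
      rw [div_le_div_iff₀ (by positivity) (by positivity)]
      have : (k : ℝ) ≤ N := by exact_mod_cast (by omega : k ≤ N)
      linarith
    have hb : ∀ i, dist (s i) (tupleBarycenter κ k q) ≤ N / (N + 1) * r :=
      hs.2 _ _ fun j => by
        rw [dist_comm]; exact (dist_tupleBarycenter_le k q hq j).trans hle
    refine ⟨fun i j => ?_, fun x R hx i => ?_⟩
    · refine Fin.cases ?_ (fun i => ?_) i <;> refine Fin.cases ?_ (fun j => ?_) j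
      · simp only [dist_self]; positivity
      · simp only [Fin.cons_zero, Fin.cons_succ]; rw [dist_comm]; exact hb j
      · simp only [Fin.cons_zero, Fin.cons_succ]; exact hb i
      · simp only [Fin.cons_succ]; exact hs.1 i j
    · refine Fin.cases ?_ (fun i => ?_) i
      · simp only [Fin.cons_zero]; exact dist_affineTuple_le _ _ _ hx
      · simp only [Fin.cons_succ]; exact hs.2 x R hx i

lemma iterate_tupleSubdivision_mem_supported (N : ℕ) {r : ℝ} (hr : 0 ≤ r)
    (q : Fin (N + 1) → stdSimplex ℝ κ) (hq : ∀ i j, dist (q i) (q j) ≤ r) (m : ℕ) :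
    (tupleSubdivision (tupleBarycenter κ) (N + 1))^[m] (Finsupp.single q 1) ∈
      Finsupp.supported ℤ ℤ {s | ∀ i j, dist (s i) (s j) ≤ (N / (N + 1)) ^ m * r} := by
  induction m with
  | zero => exact Finsupp.single_mem_supported _ _ (by simpa using hq)
  | succ m ih =>
    rw [Function.iterate_succ_apply']
    refine Finsupp.map_mem_of_mem_supported _ _ (fun s hs => ?_) ih
    refine Finsupp.supported_mono ?_
      (tupleSubdivision_mem_supported N (by positivity) (N + 1) le_rfl s hs)
    intro t ht
    simpa [pow_succ', mul_assoc] using ht.1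

end AffineSimplices

/-! ### Subdivision of singular chains -/

section Singular

variable {X : TopCat.{u}}

lemma toSSetObjEquiv_δ {n : ℕ} (i : Fin (n + 2)) (σ : (TopCat.toSSet.obj X) _⦋n + 1⦌)
    (t : stdSimplex ℝ (Fin (n + 1))) :
    X.toSSetObjEquiv (op ⦋n⦌) ((TopCat.toSSet.obj X).δ i σ) t =
      X.toSSetObjEquiv (op ⦋n + 1⦌) σ (stdSimplex.map i.succAbove t) := rfl

/-- The restriction of a singular simplex to an affine simplex in its domain. -/
def singularRestrict {n m : ℕ} (σ : (TopCat.toSSet.obj X) _⦋n⦌)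
    (q : Fin (m + 1) → stdSimplex ℝ (Fin (n + 1))) : (TopCat.toSSet.obj X) _⦋m⦌ :=
  (X.toSSetObjEquiv (op ⦋m⦌)).symm ((X.toSSetObjEquiv (op ⦋n⦌) σ).comp (affineTupleMap q))

lemma toSSetObjEquiv_singularRestrict {n m : ℕ} (σ : (TopCat.toSSet.obj X) _⦋n⦌)
    (q : Fin (m + 1) → stdSimplex ℝ (Fin (n + 1))) (t : stdSimplex ℝ (Fin (m + 1))) :
    X.toSSetObjEquiv (op ⦋m⦌) (singularRestrict σ q) t =
      X.toSSetObjEquiv (op ⦋n⦌) σ (affineTuple q t) := by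
  rw [singularRestrict, Equiv.apply_symm_apply]; rfl

lemma toSSet_ext {n : ℕ} {σ τ : (TopCat.toSSet.obj X) _⦋n⦌}
    (h : ∀ t, X.toSSetObjEquiv (op ⦋n⦌) σ t = X.toSSetObjEquiv (op ⦋n⦌) τ t) : σ = τ :=
  (X.toSSetObjEquiv (op ⦋n⦌)).injective (ContinuousMap.ext h)

lemma singularRestrict_vertex {n : ℕ} (σ : (TopCat.toSSet.obj X) _⦋n⦌) :
    singularRestrict σ stdSimplex.vertex = σ :=
  toSSet_ext fun t => by rw [toSSetObjEquiv_singularRestrict, affineTuple_vertex_self]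

lemma singularRestrict_singularRestrict {n m k : ℕ} (σ : (TopCat.toSSet.obj X) _⦋n⦌)
    (p : Fin (m + 1) → stdSimplex ℝ (Fin (n + 1))) (q : Fin (k + 1) → stdSimplex ℝ (Fin (m + 1))) :
    singularRestrict (singularRestrict σ p) q = singularRestrict σ (affineTuple p ∘ q) :=
  toSSet_ext fun t => by simp only [toSSetObjEquiv_singularRestrict, affineTuple_affineTuple]

lemma singularRestrict_δ {n m : ℕ} (σ : (TopCat.toSSet.obj X) _⦋n⦌)
    (q : Fin (m + 2) → stdSimplex ℝ (Fin (n + 1))) (i : Fin (m + 2)) :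
    (TopCat.toSSet.obj X).δ i (singularRestrict σ q) = singularRestrict σ (q ∘ i.succAbove) :=
  toSSet_ext fun t => by
    rw [toSSetObjEquiv_δ, toSSetObjEquiv_singularRestrict, toSSetObjEquiv_singularRestrict,
      stdSimplex_map_eq_affineTuple, affineTuple_affineTuple]
    congr 2
    funext j
    exact affineTuple_vertex ..

/-- The chain map from chains of tuples to singular chains, along a singular simplex. -/
def singularPush {n : ℕ} (σ : (TopCat.toSSet.obj X) _⦋n⦌) (m : ℕ) :
    ((Fin (m + 1) → stdSimplex ℝ (Fin (n + 1))) →₀ ℤ) →ₗ[ℤ]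
      ((TopCat.toSSet.obj X) _⦋m⦌ →₀ ℤ) :=
  Finsupp.lmapDomain ℤ ℤ (singularRestrict σ)

lemma singularPush_single {n m : ℕ} (σ : (TopCat.toSSet.obj X) _⦋n⦌)
    (q : Fin (m + 1) → stdSimplex ℝ (Fin (n + 1))) (r : ℤ) :
    singularPush σ m (Finsupp.single q r) = Finsupp.single (singularRestrict σ q) r :=
  Finsupp.mapDomain_single

/-- With this compatibility, operators on tuples that commute with affine maps induce natural
operators on singular chains. -/
lemma singularPush_singularRestrict {n m k : ℕ} (σ : (TopCat.toSSet.obj X) _⦋n⦌)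
    (p : Fin (m + 1) → stdSimplex ℝ (Fin (n + 1)))
    (c : (Fin (k + 1) → stdSimplex ℝ (Fin (m + 1))) →₀ ℤ) :
    singularPush (singularRestrict σ p) k c = singularPush σ k (tupleMap (affineTuple p) (k + 1) c) := by
  suffices singularPush (singularRestrict σ p) k =
    (singularPush σ k) ∘ₗ (tupleMap (affineTuple p) (k + 1)) from LinearMap.congr_fun this c
  refine tuple_hom_ext fun q => ?_
  rw [LinearMap.comp_apply, tupleMap_single, singularPush_single, singularPush_single,
    singularRestrict_singularRestrict]

/-- The differential of the singular chain complex. -/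
def singularBoundary (X : TopCat.{u}) (n : ℕ) :
    ((TopCat.toSSet.obj X) _⦋n + 1⦌ →₀ ℤ) →ₗ[ℤ] ((TopCat.toSSet.obj X) _⦋n⦌ →₀ ℤ) :=
  ((freeComplex.obj (TopCat.toSSet.obj X)).d (n + 1) n).hom

lemma singularBoundary_push {n m : ℕ} (σ : (TopCat.toSSet.obj X) _⦋n⦌)
    (c : (Fin (m + 2) → stdSimplex ℝ (Fin (n + 1))) →₀ ℤ) :
    singularBoundary X m (singularPush σ (m + 1) c) = singularPush σ m (tupleBoundary _ (m + 1) c) := by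
  suffices (singularBoundary X m) ∘ₗ (singularPush σ (m + 1)) =
    (singularPush σ m) ∘ₗ (tupleBoundary _ (m + 1)) from LinearMap.congr_fun this c
  refine tuple_hom_ext fun q => ?_
  rw [LinearMap.comp_apply, LinearMap.comp_apply, tupleBoundary_single, singularPush_single, map_sum,
    singularBoundary]
  refine (freeComplex_d_single _ _ _).trans (Finset.sum_congr rfl fun i _ => ?_)
  rw [map_zsmul, singularPush_single, singularRestrict_δ]

/-- The natural operator on singular chains induced by a family of operators on chains of tuples. -/
def singularOperator (X : TopCat.{u}) (n m : ℕ)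
    (F : ((Fin (n + 1) → stdSimplex ℝ (Fin (n + 1))) →₀ ℤ) →ₗ[ℤ]
      ((Fin (m + 1) → stdSimplex ℝ (Fin (n + 1))) →₀ ℤ)) :
    ((TopCat.toSSet.obj X) _⦋n⦌ →₀ ℤ) →ₗ[ℤ] ((TopCat.toSSet.obj X) _⦋m⦌ →₀ ℤ) :=
  Finsupp.linearCombination ℤ fun σ =>
    singularPush σ m (F (Finsupp.single stdSimplex.vertex 1))

/-- Barycentric subdivision of singular chains. -/
def singularSubdivision (X : TopCat.{u}) (n : ℕ) :
    ((TopCat.toSSet.obj X) _⦋n⦌ →₀ ℤ) →ₗ[ℤ] ((TopCat.toSSet.obj X) _⦋n⦌ →₀ ℤ) :=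
  singularOperator X n n (tupleSubdivision (tupleBarycenter _) (n + 1))

/-- The natural chain homotopy between barycentric subdivision and the identity. -/
def singularHomotopy (X : TopCat.{u}) (n : ℕ) :
    ((TopCat.toSSet.obj X) _⦋n⦌ →₀ ℤ) →ₗ[ℤ] ((TopCat.toSSet.obj X) _⦋n + 1⦌ →₀ ℤ) :=
  singularOperator X n (n + 1) (tupleHomotopy (tupleBarycenter _) (n + 1))

lemma singularSubdivision_push {n m : ℕ} (σ : (TopCat.toSSet.obj X) _⦋n⦌)
    (c : (Fin (m + 1) → stdSimplex ℝ (Fin (n + 1))) →₀ ℤ) :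
    singularSubdivision X m (singularPush σ m c) =
      singularPush σ m (tupleSubdivision (tupleBarycenter _) (m + 1) c) := by
  suffices (singularSubdivision X m) ∘ₗ (singularPush σ m) =
    (singularPush σ m) ∘ₗ (tupleSubdivision (tupleBarycenter _) (m + 1)) from
    LinearMap.congr_fun this c
  refine tuple_hom_ext fun q => ?_
  rw [LinearMap.comp_apply, LinearMap.comp_apply, singularPush_single, singularSubdivision,
    singularOperator, linearCombination_single_one, singularPush_singularRestrict,
    tupleMap_subdivision (affineTuple_tupleBarycenter q), tupleMap_single]
  rw [show affineTuple q ∘ stdSimplex.vertex = q from funext fun i => affineTuple_vertex q i]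

lemma singularHomotopy_push {n m : ℕ} (σ : (TopCat.toSSet.obj X) _⦋n⦌)
    (c : (Fin (m + 1) → stdSimplex ℝ (Fin (n + 1))) →₀ ℤ) :
    singularHomotopy X m (singularPush σ m c) =
      singularPush σ (m + 1) (tupleHomotopy (tupleBarycenter _) (m + 1) c) := by
  suffices (singularHomotopy X m) ∘ₗ (singularPush σ m) =
    (singularPush σ (m + 1)) ∘ₗ (tupleHomotopy (tupleBarycenter _) (m + 1)) from
    LinearMap.congr_fun this c
  refine tuple_hom_ext fun q => ?_
  rw [LinearMap.comp_apply, LinearMap.comp_apply, singularPush_single, singularHomotopy,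
    singularOperator, linearCombination_single_one, singularPush_singularRestrict,
    tupleMap_homotopy (affineTuple_tupleBarycenter q), tupleMap_single]
  rw [show affineTuple q ∘ stdSimplex.vertex = q from funext fun i => affineTuple_vertex q i]

/-- Each singular simplex is the image of the universal tuple of vertices, so identities between
operators need only be proved for tuples. -/
lemma single_eq_singularPush {n : ℕ} (σ : (TopCat.toSSet.obj X) _⦋n⦌) :
    Finsupp.single σ (1 : ℤ) = singularPush σ n (Finsupp.single stdSimplex.vertex 1) := by
  rw [singularPush_single, singularRestrict_vertex]

lemma singularBoundary_homotopy_zero (z : (TopCat.toSSet.obj X) _⦋0⦌ →₀ ℤ) :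
    singularBoundary X 0 (singularHomotopy X 0 z) = z - singularSubdivision X 0 z := by
  suffices (singularBoundary X 0) ∘ₗ (singularHomotopy X 0) =
    LinearMap.id - singularSubdivision X 0 from LinearMap.congr_fun this z
  refine Finsupp.lhom_ext' fun σ => LinearMap.ext_ring ?_
  change singularBoundary X 0 (singularHomotopy X 0 (Finsupp.single σ 1)) =
    Finsupp.single σ 1 - singularSubdivision X 0 (Finsupp.single σ 1)
  rw [single_eq_singularPush, singularHomotopy_push, singularBoundary_push, tupleBoundary_homotopy,
    singularSubdivision_push, map_sub, map_sub]
  -- The remaining term is the homotopy on empty tuples, which is 0 by definition.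
  simp [tupleHomotopy]

lemma singularBoundary_homotopy_succ (n : ℕ) (z : (TopCat.toSSet.obj X) _⦋n + 1⦌ →₀ ℤ) :
    singularBoundary X (n + 1) (singularHomotopy X (n + 1) z) =
      z - singularSubdivision X (n + 1) z - singularHomotopy X n (singularBoundary X n z) := by
  suffices (singularBoundary X (n + 1)) ∘ₗ (singularHomotopy X (n + 1)) =
    LinearMap.id - singularSubdivision X (n + 1) - (singularHomotopy X n) ∘ₗ (singularBoundary X n)
    from LinearMap.congr_fun this z
  refine Finsupp.lhom_ext' fun σ => LinearMap.ext_ring ?_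
  change singularBoundary X (n + 1) (singularHomotopy X (n + 1) (Finsupp.single σ 1)) =
    Finsupp.single σ 1 - singularSubdivision X (n + 1) (Finsupp.single σ 1) -
    singularHomotopy X n (singularBoundary X n (Finsupp.single σ 1))
  rw [single_eq_singularPush, singularHomotopy_push, singularBoundary_push, tupleBoundary_homotopy,
    singularSubdivision_push, map_sub, map_sub, singularBoundary_push, singularHomotopy_push]

end Singular

end

section

open CategoryTheory.Limits AlgebraicTopology Simplicial Opposite

/-! ### The theorem on small simplices -/

section SmallSimplices

variable {X : TopCat.{u}}

/-- The singular simplices with image in a subset. -/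
def singularSubcomplex (A : Set X) : (TopCat.toSSet.obj X).Subcomplex where
  obj n := {σ | ∀ t, X.toSSetObjEquiv n σ t ∈ A}
  map f _ h t := h (stdSimplex.map f.unop t)

/-- The analogue for unions fails, since a simplex in `A ∪ B` need lie in neither set; subdivision
repairs this up to homology. -/
lemma singularSubcomplex_inf (A B : Set X) :
    singularSubcomplex A ⊓ singularSubcomplex B = singularSubcomplex (A ∩ B) := by
  ext n σ
  exact forall_and.symm

lemma singularRestrict_mem {n m : ℕ} {A : Set X} {σ : (TopCat.toSSet.obj X) _⦋n⦌}
    (h : σ ∈ (singularSubcomplex A).obj (op ⦋n⦌)) (q : Fin (m + 1) → stdSimplex ℝ (Fin (n + 1))) :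
    singularRestrict σ q ∈ (singularSubcomplex A).obj (op ⦋m⦌) := fun t => by
  rw [toSSetObjEquiv_singularRestrict]; exact h _

variable (A B : Set X)

lemma singularPush_mem_supported {n m : ℕ} {σ : (TopCat.toSSet.obj X) _⦋n⦌}
    (h : σ ∈ (singularSubcomplex A ⊔ singularSubcomplex B).obj (op ⦋n⦌))
    (c : (Fin (m + 1) → stdSimplex ℝ (Fin (n + 1))) →₀ ℤ) :
    singularPush σ m c ∈ Finsupp.supported ℤ ℤ
      ((singularSubcomplex A ⊔ singularSubcomplex B).obj (op ⦋m⦌)) := by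
  refine Finsupp.map_mem_of_mem_supported (A := Set.univ) _ _ (fun q _ => ?_)
    (by rw [Finsupp.supported_univ]; trivial)
  rw [singularPush_single]
  exact Finsupp.single_mem_supported _ _
    (h.imp (fun h => singularRestrict_mem h q) (fun h => singularRestrict_mem h q))

lemma singularOperator_mem_supported {n m : ℕ} (F) {z : (TopCat.toSSet.obj X) _⦋n⦌ →₀ ℤ}
    (hz : z ∈ Finsupp.supported ℤ ℤ
      ((singularSubcomplex A ⊔ singularSubcomplex B).obj (op ⦋n⦌))) :
    singularOperator X n m F z ∈ Finsupp.supported ℤ ℤ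
      ((singularSubcomplex A ⊔ singularSubcomplex B).obj (op ⦋m⦌)) := by
  refine Finsupp.map_mem_of_mem_supported _ _ (fun σ hσ => ?_) hz
  rw [singularOperator, linearCombination_single_one]
  exact singularPush_mem_supported A B hσ _

lemma iterate_singularSubdivision_push {n m : ℕ} (σ : (TopCat.toSSet.obj X) _⦋n⦌) (k : ℕ)
    (c : (Fin (m + 1) → stdSimplex ℝ (Fin (n + 1))) →₀ ℤ) :
    (singularSubdivision X m)^[k] (singularPush σ m c) =
      singularPush σ m ((tupleSubdivision (tupleBarycenter _) (m + 1))^[k] c) := by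
  induction k with
  | zero => rfl
  | succ k ih =>
    rw [Function.iterate_succ_apply', Function.iterate_succ_apply', ih, singularSubdivision_push]

variable {A B}

/-- Take a Lebesgue number of the pulled-back cover of the compact standard simplex. Each
subdivision shrinks the mesh by the factor n/(n+1), so eventually every piece lies in one preimage.
-/
lemma exists_iterate_singularSubdivision_single_mem (hA : IsOpen A) (hB : IsOpen B)
    (hAB : A ∪ B = Set.univ) {n : ℕ} (σ : (TopCat.toSSet.obj X) _⦋n⦌) :
    ∃ k, (singularSubdivision X n)^[k] (Finsupp.single σ (1 : ℤ)) ∈ Finsupp.supported ℤ ℤ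
      ((singularSubcomplex A ⊔ singularSubcomplex B).obj (op ⦋n⦌)) := by
  let f := X.toSSetObjEquiv (op ⦋n⦌) σ
  obtain ⟨δ, hδ, hball⟩ := lebesgue_number_lemma_of_metric (s := (Set.univ : Set (stdSimplex ℝ (Fin (n + 1)))))
    (ι := Bool) (c := fun b => f ⁻¹' (if b then A else B)) isCompact_univ
    (fun b => by cases b <;> simp [hA.preimage f.continuous, hB.preimage f.continuous]) (fun t _ => by
      have : f t ∈ A ∪ B := hAB ▸ Set.mem_univ _
      rcases this with h | h
      · exact Set.mem_iUnion.2 ⟨true, by simpa using h⟩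
      · exact Set.mem_iUnion.2 ⟨false, by simpa using h⟩)
  have hbd : ∀ x y : stdSimplex ℝ (Fin (n + 1)), dist x y ≤ Metric.diam (Set.univ : Set (stdSimplex ℝ (Fin (n + 1)))) :=
    fun x y => Metric.dist_le_diam_of_mem isCompact_univ.isBounded trivial trivial
  set r := Metric.diam (Set.univ : Set (stdSimplex ℝ (Fin (n + 1)))) with hr
  have hr0 : 0 ≤ r := Metric.diam_nonneg
  have hlim : Filter.Tendsto (fun k : ℕ => ((n : ℝ) / (n + 1)) ^ k * r) Filter.atTop (nhds (0 * r)) :=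
    (tendsto_pow_atTop_nhds_zero_of_lt_one (by positivity)
      (by rw [div_lt_one (by positivity)]; linarith)).mul_const r
  rw [zero_mul] at hlim
  obtain ⟨k, hk⟩ := (hlim.eventually (gt_mem_nhds hδ)).exists
  refine ⟨k, ?_⟩
  rw [single_eq_singularPush, iterate_singularSubdivision_push]
  refine Finsupp.map_mem_of_mem_supported _ _ (fun q hq => ?_)
    (iterate_tupleSubdivision_mem_supported n hr0 stdSimplex.vertex (fun _ _ => hbd _ _) k)
  rw [singularPush_single]
  refine Finsupp.single_mem_supported _ _ ?_
  obtain ⟨b, hb⟩ := hball (q 0) trivial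
  have key : ∀ t, f (affineTuple q t) ∈ (if b then A else B) := fun t =>
    hb (Metric.mem_ball.2 (lt_of_le_of_lt (dist_affineTuple_le q t _ fun i => hq i 0) hk))
  cases b
  · exact Or.inr fun t => by rw [toSSetObjEquiv_singularRestrict]; exact key t
  · exact Or.inl fun t => by rw [toSSetObjEquiv_singularRestrict]; exact key t

/-- Asking for all `l ≥ k` lets the thresholds of two summands be combined by a maximum. -/
lemma exists_iterate_singularSubdivision_mem (hA : IsOpen A) (hB : IsOpen B)
    (hAB : A ∪ B = Set.univ) {n : ℕ} (z : (TopCat.toSSet.obj X) _⦋n⦌ →₀ ℤ) :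
    ∃ k, ∀ l, k ≤ l → (singularSubdivision X n)^[l] z ∈ Finsupp.supported ℤ ℤ
      ((singularSubcomplex A ⊔ singularSubcomplex B).obj (op ⦋n⦌)) := by
  induction z using Finsupp.induction_linear with
  | zero => exact ⟨0, fun l _ => by rw [iterate_map_zero]; exact Submodule.zero_mem _⟩
  | add a b ha hb =>
    obtain ⟨k, hk⟩ := ha
    obtain ⟨m, hm⟩ := hb
    refine ⟨max k m, fun l hl => ?_⟩
    rw [iterate_map_add]
    exact Submodule.add_mem _ (hk l (le_trans (le_max_left _ _) hl))
      (hm l (le_trans (le_max_right _ _) hl))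
  | single σ r =>
    obtain ⟨k, hk⟩ := exists_iterate_singularSubdivision_single_mem hA hB hAB σ
    refine ⟨k, fun l hl => ?_⟩
    have h1 : Finsupp.single σ r = r • Finsupp.single σ (1 : ℤ) := by simp
    rw [h1, iterate_map_zsmul]
    refine Submodule.smul_mem _ _ ?_
    induction l, hl using Nat.le_induction with
    | base => exact hk
    | succ l _ ih =>
      rw [Function.iterate_succ_apply']
      exact singularOperator_mem_supported A B _ ih

lemma range_freeComplex_map_ι {S : SSet.{u}} (P : S.Subcomplex) (n : ℕ) :
    LinearMap.range ((freeComplex.map P.ι).f n).hom =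
      (Finsupp.supported ℤ ℤ (P.obj (op ⦋n⦌)) : Submodule ℤ (S _⦋n⦌ →₀ ℤ)) := by
  have h1 := Finsupp.lmapDomain_supported (M := ℤ) ℤ
    (Subtype.val : P.obj (op ⦋n⦌) → S _⦋n⦌) Set.univ
  rw [Finsupp.supported_univ, Submodule.map_top, Set.image_univ, Subtype.range_coe] at h1
  exact h1

lemma singularBoundary_mem_supported (P : (TopCat.toSSet.obj X).Subcomplex) {n : ℕ}
    {z : (TopCat.toSSet.obj X) _⦋n + 1⦌ →₀ ℤ}
    (hz : z ∈ Finsupp.supported ℤ ℤ (P.obj (op ⦋n + 1⦌))) :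
    singularBoundary X n z ∈ Finsupp.supported ℤ ℤ (P.obj (op ⦋n⦌)) := by
  refine Finsupp.map_mem_of_mem_supported _ _ (fun σ hσ => ?_) hz
  rw [singularBoundary]
  erw [freeComplex_d_single]
  exact Submodule.sum_mem _ fun i _ => Submodule.smul_mem _ _
    (Finsupp.single_mem_supported _ _ (P.map (SimplexCategory.δ i).op hσ))

lemma singularBoundary_singularBoundary (n : ℕ) (z : (TopCat.toSSet.obj X) _⦋n + 2⦌ →₀ ℤ) :
    singularBoundary X n (singularBoundary X (n + 1) z) = 0 :=
  LinearMap.congr_fun (congrArg ModuleCat.Hom.hom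
    ((freeComplex.obj (TopCat.toSSet.obj X)).d_comp_d (n + 2) (n + 1) n)) z

/-- Induction on the number of subdivisions needed. With S the subdivision and T the homotopy, z -
Sz = ∂Tz + T∂z, and T∂z is small because ∂z is; so z may be replaced by Sz. -/
lemma exists_sub_singularBoundary_mem (hA : IsOpen A) (hB : IsOpen B)
    (hAB : A ∪ B = Set.univ) (n : ℕ) (z : (TopCat.toSSet.obj X) _⦋n⦌ →₀ ℤ)
    (hz : ∀ m (h : n = m + 1), singularBoundary X m (h ▸ z) ∈ Finsupp.supported ℤ ℤ
      ((singularSubcomplex A ⊔ singularSubcomplex B).obj (op ⦋m⦌))) :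
    ∃ w, z - singularBoundary X n w ∈ Finsupp.supported ℤ ℤ
      ((singularSubcomplex A ⊔ singularSubcomplex B).obj (op ⦋n⦌)) := by
  obtain ⟨k, hk⟩ := exists_iterate_singularSubdivision_mem hA hB hAB z
  replace hk := hk k le_rfl
  induction k generalizing z with
  | zero => exact ⟨0, by simpa using hk⟩
  | succ k ih =>
    rw [Function.iterate_succ_apply] at hk
    cases n with
    | zero =>
      obtain ⟨w, hw⟩ := ih _ (fun m h => absurd h (by omega)) hk
      refine ⟨singularHomotopy X 0 z + w, ?_⟩
      rwa [map_add, singularBoundary_homotopy_zero, sub_add_eq_sub_sub, sub_sub_cancel]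
    | succ n =>
      have hT := singularOperator_mem_supported A B
        (tupleHomotopy (tupleBarycenter _) (n + 1)) (hz n rfl)
      change singularHomotopy X n (singularBoundary X n z) ∈ _ at hT
      have hS : singularSubdivision X (n + 1) z = z -
          singularBoundary X (n + 1) (singularHomotopy X (n + 1) z) -
          singularHomotopy X n (singularBoundary X n z) := by
        rw [singularBoundary_homotopy_succ]; abel
      -- The boundary of Sz is ∂z - ∂T∂z, again small, so the induction hypothesis applies.
      obtain ⟨w, hw⟩ := ih (singularSubdivision X (n + 1) z) (fun m h => by
        obtain rfl : n = m := by omega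
        change singularBoundary X n (singularSubdivision X (n + 1) z) ∈ _
        rw [hS, map_sub, map_sub, singularBoundary_singularBoundary, sub_zero]
        exact Submodule.sub_mem _ (hz n rfl) (singularBoundary_mem_supported _ hT)) hk
      refine ⟨singularHomotopy X (n + 1) z + w, ?_⟩
      have h2 := Submodule.add_mem _ hw hT
      rw [hS] at h2
      rw [map_add]
      convert h2 using 1
      abel

lemma quasiIso_smallSimplices (hA : IsOpen A) (hB : IsOpen B) (hAB : A ∪ B = Set.univ) :
    QuasiIso (freeComplex.map (singularSubcomplex A ⊔ singularSubcomplex B).ι) := by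
  have : Mono (freeComplex.map (singularSubcomplex A ⊔ singularSubcomplex B).ι) := by
    refine HomologicalComplex.mono_of_mono_f _ fun n => ?_
    rw [ModuleCat.mono_iff_injective]
    exact freeComplex_map_injective _ (fun m => Subtype.val_injective) n
  refine HomologicalComplex.quasiIso_of_exists_sub_mem_range _ fun n z hz => ?_
  rw [range_freeComplex_map_ι]
  simp only [range_freeComplex_map_ι] at hz
  exact exists_sub_singularBoundary_mem hA hB hAB n z fun m h => by subst h; exact hz m

lemma singularSubcomplex_eq_range (A : Set X) :
    singularSubcomplex A = SSet.Subcomplex.range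
      (TopCat.toSSet.map (TopCat.ofHom ⟨Subtype.val, continuous_subtype_val⟩ : TopCat.of A ⟶ X)) := by
  ext n σ
  constructor
  · intro h
    refine ⟨((TopCat.of A).toSSetObjEquiv n).symm ⟨fun t => ⟨_, h t⟩,
      (ContinuousMap.continuous _).subtype_mk _⟩, ?_⟩
    apply (X.toSSetObjEquiv n).injective
    rfl
  · rintro ⟨τ, rfl⟩ t
    exact ((TopCat.of A).toSSetObjEquiv n τ t).2

/-- Singular simplices with image in a subset are the singular simplices of the subspace. -/
def singularSubcomplexIso (A : Set X) :
    TopCat.toSSet.obj (TopCat.of A) ≅ (singularSubcomplex A).toSSet :=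
  have : Mono (TopCat.ofHom ⟨Subtype.val, continuous_subtype_val⟩ : TopCat.of A ⟶ X) :=
    (TopCat.mono_iff_injective _).2 Subtype.val_injective
  asIso (SSet.Subcomplex.toRange
      (TopCat.toSSet.map (TopCat.ofHom ⟨Subtype.val, continuous_subtype_val⟩ : TopCat.of A ⟶ X))) ≪≫
    SSet.Subcomplex.eqToIso (singularSubcomplex_eq_range A).symm

lemma hasEulerCharacteristic_subset_iff (A : Set X) (χ : ℤ) :
    HasEulerCharacteristic A χ ↔
      HasHomologyEuler (freeComplex.obj (singularSubcomplex A).toSSet) χ := by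
  have e := freeComplex.mapIso (singularSubcomplexIso A)
  rw [hasEulerCharacteristic_iff]
  exact ⟨fun h => h.of_iso e, fun h => h.of_iso e.symm⟩

end SmallSimplices

/-! ### Additivity and homotopy invariance of the Euler characteristic -/

section EulerCharacteristic

/-- Additivity of the Euler characteristic for an open cover by two sets. -/
lemma HasEulerCharacteristic.union_of_isOpen {X : Type u} [TopologicalSpace X] {A B : Set X}
    (hA : IsOpen A) (hB : IsOpen B) (hAB : A ∪ B = Set.univ) {a b c : ℤ}
    (ha : HasEulerCharacteristic A a) (hb : HasEulerCharacteristic B b)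
    (hc : HasEulerCharacteristic (A ∩ B : Set X) c) : HasEulerCharacteristic X (a + b - c) := by
  rw [hasEulerCharacteristic_iff]
  have := quasiIso_smallSimplices (X := TopCat.of X) hA hB hAB
  refine HasHomologyEuler.of_quasiIso
    (freeComplex.map (singularSubcomplex (X := TopCat.of X) A ⊔ singularSubcomplex B).ι) ?_
  refine HasHomologyEuler.sup ((hasEulerCharacteristic_subset_iff (X := TopCat.of X) A a).1 ha)
    ((hasEulerCharacteristic_subset_iff (X := TopCat.of X) B b).1 hb) ?_
  rw [singularSubcomplex_inf]
  exact (hasEulerCharacteristic_subset_iff (X := TopCat.of X) (A ∩ B) c).1 hc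

lemma HasEulerCharacteristic.of_homotopyEquiv {X Y : Type u} [TopologicalSpace X]
    [TopologicalSpace Y] (e : ContinuousMap.HomotopyEquiv X Y) {χ : ℤ}
    (h : HasEulerCharacteristic X χ) : HasEulerCharacteristic Y χ := by
  refine HasGradedEuler.congr (R := ℤ) h fun i => ⟨Iso.toLinearEquiv ?_⟩
  let H := (singularHomologyFunctor (ModuleCat.{u} ℤ) i).obj (ModuleCat.of ℤ (ULift.{u} ℤ))
  let f : TopCat.of X ⟶ TopCat.of Y := TopCat.ofHom e.toFun
  let g : TopCat.of Y ⟶ TopCat.of X := TopCat.ofHom e.invFun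
  have h1 : H.map (f ≫ g) = H.map (𝟙 _) :=
    TopCat.Homotopy.congr_homologyMap_singularChainComplexFunctor
      (f := f ≫ g) (g := 𝟙 (TopCat.of X)) e.left_inv.some _ i
  have h2 : H.map (g ≫ f) = H.map (𝟙 _) :=
    TopCat.Homotopy.congr_homologyMap_singularChainComplexFunctor
      (f := g ≫ f) (g := 𝟙 (TopCat.of Y)) e.right_inv.some _ i
  exact { hom := H.map f, inv := H.map g
          hom_inv_id := ((H.map_comp f g).symm.trans h1).trans (H.map_id _)
          inv_hom_id := ((H.map_comp g f).symm.trans h2).trans (H.map_id _) }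

lemma HasEulerCharacteristic.of_homeomorph {X Y : Type u} [TopologicalSpace X]
    [TopologicalSpace Y] (e : X ≃ₜ Y) {χ : ℤ}
    (h : HasEulerCharacteristic X χ) : HasEulerCharacteristic Y χ :=
  h.of_homotopyEquiv e.toHomotopyEquiv

lemma hasEulerCharacteristic_of_finite (X : Type u) [TopologicalSpace X] [DiscreteTopology X]
    [Finite X] : HasEulerCharacteristic X (Nat.card X) := by
  have e : integralHomology X 0 ≃ₗ[ℤ] (X →₀ ℤ) :=
    (singularHomologyFunctorZeroOfTotallyDisconnectedSpace _ _ (TopCat.of X) ≪≫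
      sigmaConstIsoFree.app X).toLinearEquiv
  have hs : ∀ i, 1 ≤ i → Subsingleton (integralHomology X i) := fun i hi =>
    ModuleCat.subsingleton_of_isZero
      (isZero_singularHomologyFunctor_of_totallyDisconnectedSpace _ i _ (TopCat.of X) (by omega))
  refine (hasGradedEuler_iff_of_bound (R := ℤ) hs _).2 ⟨?_, ?_⟩
  · rintro (_ | i)
    · exact Module.Finite.equiv e.symm
    · have := hs (i + 1) (by omega)
      infer_instance
  · have := Fintype.ofFinite X
    simp [e.finrank_eq]

/-- A subset of a subspace, viewed as a subspace of the ambient space. -/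
def Homeomorph.preimageVal {Z : Type*} [TopologicalSpace Z] (S : Set Z) (A : Set S) (B : Set Z)
    (h : ∀ x : S, x ∈ A ↔ x.1 ∈ B) : (S ∩ B : Set Z) ≃ₜ A where
  toFun x := ⟨⟨x.1, x.2.1⟩, (h _).2 x.2.2⟩
  invFun x := ⟨x.1.1, x.1.2, (h _).1 x.2⟩
  left_inv _ := rfl
  right_inv _ := rfl
  continuous_toFun := by fun_prop
  continuous_invFun := by fun_prop

/-- Additivity of the Euler characteristic of a subspace covered by two open sets. -/
lemma HasEulerCharacteristic.of_cover {Z : Type u} [TopologicalSpace Z] {S A B : Set Z}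
    (hA : IsOpen A) (hB : IsOpen B) (hS : S ⊆ A ∪ B) {a b c : ℤ}
    (ha : HasEulerCharacteristic (S ∩ A : Set Z) a) (hb : HasEulerCharacteristic (S ∩ B : Set Z) b)
    (hc : HasEulerCharacteristic (S ∩ (A ∩ B) : Set Z) c) :
    HasEulerCharacteristic S (a + b - c) := by
  refine HasEulerCharacteristic.union_of_isOpen (A := (Subtype.val ⁻¹' A : Set S))
    (B := (Subtype.val ⁻¹' B : Set S)) (hA.preimage continuous_subtype_val)
    (hB.preimage continuous_subtype_val) (Set.eq_univ_of_forall fun x => hS x.2)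
    (ha.of_homeomorph (.preimageVal _ _ _ fun _ => Iff.rfl))
    (hb.of_homeomorph (.preimageVal _ _ _ fun _ => Iff.rfl))
    (hc.of_homeomorph (.preimageVal _ _ _ fun _ => Iff.rfl))

lemma hasEulerCharacteristic_of_isEmpty (X : Type u) [TopologicalSpace X] [IsEmpty X] :
    HasEulerCharacteristic X 0 := by
  simpa using hasEulerCharacteristic_of_finite X

/-- Additivity of the Euler characteristic for finite disjoint unions of open pieces. -/
lemma HasEulerCharacteristic.iUnion {Z : Type u} [TopologicalSpace Z] {ι : Type*} (s : Finset ι)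
    (S : Set Z) (A : ι → Set Z) (hA : ∀ i ∈ s, IsOpen (A i))
    (hd : ∀ i ∈ s, ∀ j ∈ s, i ≠ j → Disjoint (A i) (A j)) (a : ι → ℤ)
    (ha : ∀ i ∈ s, HasEulerCharacteristic (S ∩ A i : Set Z) (a i)) :
    HasEulerCharacteristic (S ∩ ⋃ i ∈ s, A i : Set Z) (∑ i ∈ s, a i) := by
  classical
  induction s using Finset.induction_on with
  | empty =>
    have : IsEmpty (S ∩ ⋃ i ∈ (∅ : Finset ι), A i : Set Z) := by simp
    rw [Finset.sum_empty]
    exact hasEulerCharacteristic_of_isEmpty _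
  | insert i s hi ih =>
    -- The subtracted 0 is the Euler characteristic of the empty overlap.
    rw [Finset.sum_insert hi, ← sub_zero (a i + _)]
    have h1 := ih (fun j hj => hA j (Finset.mem_insert_of_mem hj))
      (fun j hj k hk => hd j (Finset.mem_insert_of_mem hj) k (Finset.mem_insert_of_mem hk))
      (fun j hj => ha j (Finset.mem_insert_of_mem hj))
    have hset : ∀ T : Set Z, T ⊆ ⋃ j ∈ insert i s, A j →
        S ∩ (⋃ j ∈ insert i s, A j) ∩ T = S ∩ T := fun T hT => by
      rw [Set.inter_assoc, Set.inter_eq_right.2 hT]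
    have hu : ⋃ j ∈ insert i s, A j = A i ∪ ⋃ j ∈ s, A j := by simp
    refine HasEulerCharacteristic.of_cover (A := A i) (B := ⋃ j ∈ s, A j)
      (hA i (Finset.mem_insert_self _ _))
      (isOpen_biUnion fun j hj => hA j (Finset.mem_insert_of_mem hj)) (by rw [hu]; simp) ?_ ?_ ?_
    · rw [hset _ (by rw [hu]; exact Set.subset_union_left)]
      exact ha i (Finset.mem_insert_self _ _)
    · rw [hset _ (by rw [hu]; exact Set.subset_union_right)]
      exact h1
    · have : IsEmpty (S ∩ (⋃ j ∈ insert i s, A j) ∩ (A i ∩ ⋃ j ∈ s, A j) : Set Z) := by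
        refine ⟨fun ⟨x, _, h2, h3⟩ => ?_⟩
        obtain ⟨j, hj, hx⟩ := Set.mem_iUnion₂.1 h3
        refine Set.disjoint_left.1 (hd i (Finset.mem_insert_self _ _) j
          (Finset.mem_insert_of_mem hj) ?_) h2 hx
        rintro rfl
        exact hi hj
      exact hasEulerCharacteristic_of_isEmpty _

end EulerCharacteristic

end

/-! ### Points, coordinates and stretching maps of a graph -/

lemma Continuous.isClosedMap_prodMap_id {K X : Type*} (Z : Type*) [TopologicalSpace K]
    [TopologicalSpace X] [TopologicalSpace Z] [CompactSpace K] [T2Space X] {k : K → X}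
    (hk : Continuous k) : IsClosedMap (Prod.map id k : Z × K → Z × X) :=
  (isProperMap_id.prodMap hk.isProperMap).isClosedMap

namespace CWGraph

variable (G : CWGraph.{u})

/-- The point of the graph underlying a vertex. -/
def vertex (v : G.V) : G.carrier :=
  RelCWComplex.map (C := (Set.univ : Set G.carrier)) 0 v ![]

/-- The characteristic map of an edge, extended to the real line by constant maps. -/
def edge (e : G.E) (s : ℝ) : G.carrier :=
  RelCWComplex.map (C := (Set.univ : Set G.carrier)) 1 e
    fun _ => (Set.projIcc (-1 : ℝ) 1 (by norm_num) s : ℝ)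

variable {G}

lemma vertexSet_eq_range : G.vertexSet = Set.range G.vertex := by
  ext x
  refine Set.mem_iUnion.trans (exists_congr fun v : RelCWComplex.cell (Set.univ : Set G.carrier) 0 =>
    (iff_of_eq ?_).trans eq_comm)
  exact congrArg (x ∈ ·) (RelCWComplex.closedCell_zero_eq_singleton (j := v))

lemma vertex_mem (v : G.V) : G.vertex v ∈ G.vertexSet := by
  rw [vertexSet_eq_range]; exact ⟨v, rfl⟩

lemma exists_eq_vertex {x : G.carrier} (hx : x ∈ G.vertexSet) : ∃ v, x = G.vertex v := by
  rw [vertexSet_eq_range] at hx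
  obtain ⟨v, hv⟩ := hx
  exact ⟨v, hv.symm⟩

lemma vertex_injective : Function.Injective G.vertex :=
  RelCWComplex.injective_map_zero (Set.univ : Set G.carrier)

lemma continuous_edge (e : G.E) : Continuous (G.edge e) := by
  refine (RelCWComplex.continuousOn (C := (Set.univ : Set G.carrier)) 1 e).comp_continuous
    (by fun_prop) fun s => ?_
  rw [mem_closedBall_zero_iff, pi_norm_le_iff_of_nonneg zero_le_one]
  exact fun _ => abs_le.2 (Set.projIcc (-1 : ℝ) 1 (by norm_num) s).2

lemma edge_of_abs_le {e : G.E} {s : ℝ} (hs : |s| ≤ 1) :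
    G.edge e s = RelCWComplex.map (C := (Set.univ : Set G.carrier)) 1 e fun _ => s := by
  rw [edge, Set.projIcc_of_mem _ (abs_le.1 hs)]

lemma edge_mem_openCell (e : G.E) {s : ℝ} (hs : |s| < 1) :
    G.edge e s ∈ RelCWComplex.openCell (C := (Set.univ : Set G.carrier)) 1 e := by
  rw [edge_of_abs_le hs.le]
  refine ⟨_, ?_, rfl⟩
  rw [mem_ball_zero_iff, pi_norm_lt_iff zero_lt_one]
  exact fun _ => hs

lemma edge_eq_edge {e e' : G.E} {s s' : ℝ} (hs : |s| < 1) (hs' : |s'| < 1)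
    (h : G.edge e s = G.edge e' s') : e = e' ∧ s = s' := by
  have h1 := RelCWComplex.eq_of_not_disjoint_openCell
    (Set.not_disjoint_iff.2 ⟨_, edge_mem_openCell e hs, h ▸ edge_mem_openCell e' hs'⟩)
  obtain rfl : e = e' := eq_of_heq (Sigma.mk.inj h1).2
  refine ⟨rfl, ?_⟩
  rw [edge_of_abs_le hs.le, edge_of_abs_le hs'.le] at h
  have hb : ∀ {r : ℝ}, |r| < 1 → (fun _ : Fin 1 => r) ∈
      (RelCWComplex.map (C := (Set.univ : Set G.carrier)) 1 e).source := by
    intro r hr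
    refine (RelCWComplex.source_eq (C := (Set.univ : Set G.carrier)) 1 e).symm ▸ ?_
    rw [mem_ball_zero_iff, pi_norm_lt_iff zero_lt_one]
    exact fun _ => hr
  exact congrFun ((RelCWComplex.map (C := (Set.univ : Set G.carrier)) 1 e).injOn
    (hb hs) (hb hs') h) 0

lemma edge_ne_vertex (e : G.E) {s : ℝ} (hs : |s| < 1) (v : G.V) : G.edge e s ≠ G.vertex v := by
  intro h
  have hv : G.vertex v ∈ RelCWComplex.openCell (C := (Set.univ : Set G.carrier)) 0 v := by
    exact (RelCWComplex.openCell_zero_eq_singleton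
      (j := (v : RelCWComplex.cell (Set.univ : Set G.carrier) 0))).symm ▸ rfl
  have h1 := RelCWComplex.eq_of_not_disjoint_openCell
    (Set.not_disjoint_iff.2 ⟨_, edge_mem_openCell e hs, h ▸ hv⟩)
  exact one_ne_zero (Sigma.mk.inj h1).1

/-- Parameters with `1 ≤ |s|` are clamped to an endpoint, which lies in the frontier of the edge and
hence in a 0-cell. -/
lemma exists_vertex_eq_edge (e : G.E) {s : ℝ} (hs : 1 ≤ |s|) :
    ∃ v, G.vertex v = G.edge e s := by
  have h : G.edge e s ∈ RelCWComplex.cellFrontier (C := (Set.univ : Set G.carrier)) 1 e := by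
    refine ⟨_, ?_, rfl⟩
    rw [mem_sphere_zero_iff_norm, pi_norm_const]
    rcases le_abs.1 hs with h | h
    · rw [Set.projIcc_of_right_le _ h]; simp
    · rw [Set.projIcc_of_le_left _ (by linarith)]; simp
  obtain ⟨I, hI⟩ := CWComplex.cellFrontier_subset_finite_closedCell 1 e
  have := hI h
  simp only [Set.mem_iUnion] at this
  obtain ⟨m, hm, v, -, hv⟩ := this
  obtain rfl : m = 0 := by omega
  rw [← Set.mem_range, ← vertexSet_eq_range]
  exact Set.mem_iUnion.2 ⟨v, hv⟩

variable (G) in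
/-- The points of a graph are the vertices and the points inside the edges. -/
def pointMap : G.V ⊕ G.E × Set.Ioo (-1 : ℝ) 1 → G.carrier :=
  Sum.elim G.vertex fun p => G.edge p.1 p.2

lemma pointMap_injective : Function.Injective G.pointMap := by
  rintro (v | ⟨e, s, hs⟩) (v' | ⟨e', s', hs'⟩) h
  · rw [vertex_injective h]
  · exact (edge_ne_vertex e' (abs_lt.2 hs') v h.symm).elim
  · exact (edge_ne_vertex e (abs_lt.2 hs) v' h).elim
  · obtain ⟨rfl, rfl⟩ := edge_eq_edge (abs_lt.2 hs) (abs_lt.2 hs') h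
    rfl

lemma exists_vertex_or_edge (x : G.carrier) :
    (∃ v, x = G.vertex v) ∨ ∃ e s, |s| < 1 ∧ x = G.edge e s := by
  have hx : x ∈ (Set.univ : Set G.carrier) := trivial
  rw [← CWComplex.iUnion_openCell_eq_complex (C := (Set.univ : Set G.carrier))] at hx
  simp only [Set.mem_iUnion] at hx
  obtain ⟨m, c, hc⟩ := hx
  match m, c, hc with
  | 0, c, hc =>
    rw [RelCWComplex.openCell_zero_eq_singleton] at hc
    exact Or.inl ⟨c, hc⟩
  | 1, c, hc =>
    obtain ⟨y, hy, rfl⟩ := hc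
    have hy0 : |y 0| < 1 := by
      rw [mem_ball_zero_iff, pi_norm_lt_iff zero_lt_one] at hy
      exact hy 0
    refine Or.inr ⟨c, y 0, hy0, ?_⟩
    refine Eq.trans ?_ (edge_of_abs_le (e := (c : G.E)) hy0.le).symm
    exact congrArg (RelCWComplex.map (C := (Set.univ : Set G.carrier)) 1 c)
      (funext fun i => by rw [Subsingleton.elim i 0])
  | m + 2, c, hc => exact ((G.isEmpty_cell (m + 2) (by omega)).false c).elim

lemma pointMap_surjective : Function.Surjective G.pointMap := by
  intro x
  rcases exists_vertex_or_edge x with ⟨v, rfl⟩ | ⟨e, s, hs, rfl⟩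
  · exact ⟨Sum.inl v, rfl⟩
  · exact ⟨Sum.inr (e, ⟨s, abs_lt.1 hs⟩), rfl⟩

/-- A function on a graph given by its values on the vertices and on the open edges. -/
def ofPieces {Y : Type*} (a : G.V → Y) (b : G.E → ℝ → Y) (x : G.carrier) : Y :=
  Sum.elim a (fun p => b p.1 p.2)
    ((Equiv.ofBijective G.pointMap ⟨pointMap_injective, pointMap_surjective⟩).symm x)

lemma ofPieces_vertex {Y : Type*} (a : G.V → Y) (b : G.E → ℝ → Y) (v : G.V) :
    ofPieces a b (G.vertex v) = a v := by
  have : (Equiv.ofBijective G.pointMap ⟨pointMap_injective, pointMap_surjective⟩).symm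
      (G.vertex v) = Sum.inl v := by
    rw [Equiv.symm_apply_eq]; rfl
  rw [ofPieces, this, Sum.elim_inl]

lemma ofPieces_edge {Y : Type*} (a : G.V → Y) (b : G.E → ℝ → Y) (e : G.E) {s : ℝ}
    (hs : |s| < 1) : ofPieces a b (G.edge e s) = b e s := by
  have : (Equiv.ofBijective G.pointMap ⟨pointMap_injective, pointMap_surjective⟩).symm
      (G.edge e s) = Sum.inr (e, ⟨s, abs_lt.1 hs⟩) := by
    rw [Equiv.symm_apply_eq]; rfl
  rw [ofPieces, this, Sum.elim_inr]

/-- Continuity of a function on a graph with a parameter can be checked on vertices and edges. -/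
lemma continuous_of_vertex_of_edge {Y Z : Type*} [TopologicalSpace Y] [TopologicalSpace Z]
    {f : Z × G.carrier → Y} (hv : ∀ v, Continuous fun z => f (z, G.vertex v))
    (he : ∀ e, Continuous fun p : Z × ℝ => f (p.1, G.edge e p.2)) : Continuous f := by
  rw [continuous_iff_isClosed]
  intro C hC
  let k (v : G.V) : Unit → G.carrier := fun _ => G.vertex v
  let l (e : G.E) : Set.Icc (-1 : ℝ) 1 → G.carrier := fun s => G.edge e s
  have hl (e) : Continuous (l e) := (continuous_edge e).comp continuous_subtype_val
  -- The preimage is a finite union of images of closed sets under products of the identity of `Z`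
  -- with maps from compact spaces; such products are closed maps.
  have key : f ⁻¹' C = (⋃ v, Prod.map id (k v) '' (f ∘ Prod.map id (k v) ⁻¹' C)) ∪
      ⋃ e, Prod.map id (l e) '' (f ∘ Prod.map id (l e) ⁻¹' C) := by
    ext ⟨z, x⟩
    constructor
    · intro h
      rcases exists_vertex_or_edge x with ⟨v, rfl⟩ | ⟨e, s, hs, rfl⟩
      · exact Or.inl (Set.mem_iUnion.2 ⟨v, (z, ()), h, rfl⟩)
      · exact Or.inr (Set.mem_iUnion.2 ⟨e, (z, ⟨s, abs_le.1 hs.le⟩), h, rfl⟩)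
    · rintro (h | h) <;> obtain ⟨e, p, hp, h⟩ := Set.mem_iUnion.1 h <;> rw [← h] <;> exact hp
  rw [key]
  refine (isClosed_iUnion_of_finite fun v => ?_).union (isClosed_iUnion_of_finite fun e => ?_)
  · exact Continuous.isClosedMap_prodMap_id Z (continuous_const) _
      (hC.preimage ((hv v).comp continuous_fst))
  · exact Continuous.isClosedMap_prodMap_id Z (hl e) _
      (hC.preimage ((he e).comp (continuous_id.prodMap continuous_subtype_val)))

lemma continuous_of_vertex_of_edge' {Y : Type*} [TopologicalSpace Y] {f : G.carrier → Y}
    (he : ∀ e, Continuous fun s => f (G.edge e s)) : Continuous f :=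
  (continuous_of_vertex_of_edge (Z := Unit) (f := fun p => f p.2) 
    (fun v => show Continuous fun _ => f (G.vertex v) from continuous_const)
    fun e => (he e).comp continuous_snd).comp (Continuous.prodMk_right ())

/-- The coordinate on the open edge `e`, extended by zero. -/
def coord (e : G.E) : G.carrier → ℝ :=
  open Classical in ofPieces (fun _ => 0) fun e' s => if e' = e then s else 0

/-- The distance to the midpoint of `e`, normalized to be `1` outside the edge. -/
def radius (e : G.E) : G.carrier → ℝ :=
  open Classical in ofPieces (fun _ => 1) fun e' s => if e' = e then |s| else 1

@[simp]
lemma coord_vertex (e : G.E) (v : G.V) : coord e (G.vertex v) = 0 := ofPieces_vertex _ _ _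

@[simp]
lemma radius_vertex (e : G.E) (v : G.V) : radius e (G.vertex v) = 1 := ofPieces_vertex _ _ _

lemma coord_edge (e : G.E) {s : ℝ} (hs : |s| < 1) : coord e (G.edge e s) = s := by
  rw [coord, ofPieces_edge _ _ _ hs, if_pos rfl]

lemma coord_edge_of_ne {e e' : G.E} (h : e' ≠ e) (s : ℝ) : coord e (G.edge e' s) = 0 := by
  rcases lt_or_ge |s| 1 with hs | hs
  · rw [coord, ofPieces_edge _ _ _ hs, if_neg h]
  · obtain ⟨v, hv⟩ := exists_vertex_eq_edge e' hs
    rw [← hv, coord_vertex]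

lemma radius_edge (e : G.E) (s : ℝ) : radius e (G.edge e s) = min 1 |s| := by
  rcases lt_or_ge |s| 1 with hs | hs
  · rw [radius, ofPieces_edge _ _ _ hs, if_pos rfl, min_eq_right hs.le]
  · obtain ⟨v, hv⟩ := exists_vertex_eq_edge e hs
    rw [← hv, radius_vertex, min_eq_left hs]

lemma radius_edge_of_ne {e e' : G.E} (h : e' ≠ e) (s : ℝ) : radius e (G.edge e' s) = 1 := by
  rcases lt_or_ge |s| 1 with hs | hs
  · rw [radius, ofPieces_edge _ _ _ hs, if_neg h]
  · obtain ⟨v, hv⟩ := exists_vertex_eq_edge e' hs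
    rw [← hv, radius_vertex]

lemma continuous_radius (e : G.E) : Continuous (radius e) := by
  refine continuous_of_vertex_of_edge' fun e' => ?_
  rcases eq_or_ne e' e with rfl | h
  · simp only [radius_edge]; fun_prop
  · simp only [radius_edge_of_ne h]; fun_prop

lemma radius_nonneg (e : G.E) (x : G.carrier) : 0 ≤ radius e x := by
  rcases exists_vertex_or_edge x with ⟨v, rfl⟩ | ⟨e', s, hs, rfl⟩
  · simp
  · rcases eq_or_ne e' e with rfl | h
    · rw [radius_edge]; positivity
    · rw [radius_edge_of_ne h]; norm_num

lemma radius_le_one (e : G.E) (x : G.carrier) : radius e x ≤ 1 := by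
  rcases exists_vertex_or_edge x with ⟨v, rfl⟩ | ⟨e', s, hs, rfl⟩
  · simp
  · rcases eq_or_ne e' e with rfl | h
    · rw [radius_edge]; exact min_le_left _ _
    · rw [radius_edge_of_ne h]

lemma edge_coord {e : G.E} {x : G.carrier} (h : radius e x < 1) : G.edge e (coord e x) = x := by
  rcases exists_vertex_or_edge x with ⟨v, rfl⟩ | ⟨e', s, hs, rfl⟩
  · simp at h
  · rcases eq_or_ne e' e with rfl | h'
    · rw [coord_edge _ hs]
    · simp [radius_edge_of_ne h'] at h

lemma abs_coord {e : G.E} {x : G.carrier} (h : radius e x < 1) : |coord e x| = radius e x := by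
  rcases exists_vertex_or_edge x with ⟨v, rfl⟩ | ⟨e', s, hs, rfl⟩
  · simp at h
  · rcases eq_or_ne e' e with rfl | h'
    · rw [coord_edge _ hs, radius_edge, min_eq_right hs.le]
    · simp [radius_edge_of_ne h'] at h

lemma not_mem_vertexSet_of_radius_lt {e : G.E} {x : G.carrier} (h : radius e x < 1) :
    x ∉ G.vertexSet := by
  rw [vertexSet_eq_range]
  rintro ⟨v, rfl⟩
  simp at h

/-- `coord e` jumps from ±1 to 0 at the ends of the edge; the factor `1 - radius e` vanishes there.
Inside the edge that factor is positive, so the product retains the sign of the coordinate and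
recovers its continuity. -/
lemma continuous_coord_mul (e : G.E) : Continuous fun x => coord e x * (1 - radius e x) := by
  refine continuous_of_vertex_of_edge' fun e' => ?_
  rcases eq_or_ne e' e with rfl | h
  · have : (fun s => coord e' (G.edge e' s) * (1 - radius e' (G.edge e' s))) =
        fun s => s * (1 - min 1 |s|) := by
      ext s
      rw [radius_edge]
      rcases lt_or_ge |s| 1 with hs | hs
      · rw [coord_edge _ hs]
      · simp [min_eq_left hs]
    rw [this]; fun_prop
  · simp only [coord_edge_of_ne h, zero_mul]; fun_prop

lemma continuousOn_coord (e : G.E) : ContinuousOn (coord e) {x | radius e x < 1} := by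
  have : ContinuousOn (fun x => coord e x * (1 - radius e x) / (1 - radius e x))
      {x | radius e x < 1} :=
    (continuous_coord_mul e).continuousOn.div
      (continuous_const.sub (continuous_radius e)).continuousOn
      fun x hx => (sub_pos.2 hx).ne'
  exact this.congr fun x hx => (mul_div_cancel_right₀ _ (sub_pos.2 hx).ne').symm

/-- The map that stretches each edge away from its midpoint by the factor `max 1 l`. -/
def stretch (l : ℝ) : G.carrier → G.carrier :=
  ofPieces G.vertex fun e s => G.edge e (max 1 l * s)

@[simp]
lemma stretch_vertex (l : ℝ) (v : G.V) : stretch l (G.vertex v) = G.vertex v :=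
  ofPieces_vertex _ _ _

lemma edge_mul (e : G.E) {s r : ℝ} (hs : 1 ≤ |s|) (hr : 1 ≤ r) :
    G.edge e (r * s) = G.edge e s := by
  rw [edge, edge]
  rcases le_abs.1 hs with h | h
  · rw [Set.projIcc_of_right_le _ h, Set.projIcc_of_right_le _ (by nlinarith)]
  · rw [Set.projIcc_of_le_left _ (by linarith : s ≤ -1),
      Set.projIcc_of_le_left _ (by nlinarith)]

lemma stretch_edge (l : ℝ) (e : G.E) (s : ℝ) :
    stretch l (G.edge e s) = G.edge e (max 1 l * s) := by
  rcases lt_or_ge |s| 1 with hs | hs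
  · rw [stretch, ofPieces_edge _ _ _ hs]
  · obtain ⟨v, hv⟩ := exists_vertex_eq_edge e hs
    rw [edge_mul e hs (le_max_left _ _), ← hv, stretch_vertex]

lemma continuous_stretch : Continuous fun p : ℝ × G.carrier => stretch p.1 p.2 := by
  refine continuous_of_vertex_of_edge (fun v => ?_) fun e => ?_
  · simp only [stretch_vertex]; fun_prop
  · simp only [stretch_edge]
    exact (continuous_edge e).comp (by fun_prop)

lemma stretch_one (x : G.carrier) : stretch 1 x = x := by
  rcases exists_vertex_or_edge x with ⟨v, rfl⟩ | ⟨e, s, hs, rfl⟩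
  · simp
  · rw [stretch_edge, max_self, one_mul]

/-- Stretching moves points away from midpoints, so punctures are respected. -/
lemma radius_le_radius_stretch (e : G.E) (l : ℝ) (x : G.carrier) :
    radius e x ≤ radius e (stretch l x) := by
  rcases exists_vertex_or_edge x with ⟨v, rfl⟩ | ⟨e', s, hs, rfl⟩
  · simp
  · rw [stretch_edge]
    rcases eq_or_ne e' e with rfl | h
    · rw [radius_edge, radius_edge, abs_mul]
      refine min_le_min_left _ (le_mul_of_one_le_left (abs_nonneg _) ?_)
      exact (le_max_left _ _).trans (le_abs_self _)
    · rw [radius_edge_of_ne h, radius_edge_of_ne h]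

/-- Stretching multiplies edge coordinates by a positive factor, hence identifies distinct points
only once they have reached a vertex. -/
lemma stretch_mem_or_eq {l : ℝ} {x y : G.carrier} (h : stretch l x = stretch l y) :
    stretch l x ∈ G.vertexSet ∨ x = y := by
  rw [vertexSet_eq_range]
  by_contra! hxy
  obtain ⟨hx, hxy⟩ := hxy
  have hy := h ▸ hx
  have key : ∀ z : G.carrier, stretch l z ∉ Set.range G.vertex →
      ∃ e s, |max 1 l * s| < 1 ∧ z = G.edge e s := by
    intro z hz
    rcases exists_vertex_or_edge z with ⟨v, rfl⟩ | ⟨e, s, hs, rfl⟩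
    · exact (hz ⟨v, (stretch_vertex l v).symm⟩).elim
    · refine ⟨e, s, ?_, rfl⟩
      by_contra! hs
      rw [stretch_edge] at hz
      exact hz (exists_vertex_eq_edge e hs)
  obtain ⟨e, s, hs, rfl⟩ := key x hx
  obtain ⟨e', s', hs', rfl⟩ := key y hy
  rw [stretch_edge, stretch_edge] at h
  obtain ⟨rfl, h'⟩ := edge_eq_edge hs hs' h
  exact hxy (congrArg _ (mul_left_cancel₀ (one_pos.trans_le (le_max_left _ _)).ne' h'))

lemma stretch_mem_vertexSet {l : ℝ} {x : G.carrier} (h : ∀ e, 1 ≤ l * radius e x) :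
    stretch l x ∈ G.vertexSet := by
  rcases exists_vertex_or_edge x with ⟨v, rfl⟩ | ⟨e, s, hs, rfl⟩
  · rw [stretch_vertex]; exact vertex_mem v
  · rw [stretch_edge, vertexSet_eq_range]
    refine exists_vertex_eq_edge e ?_
    have := h e
    rw [radius_edge, min_eq_right hs.le] at this
    rw [abs_mul]
    exact this.trans (mul_le_mul_of_nonneg_right ((le_max_right _ _).trans (le_abs_self _))
      (abs_nonneg _))

end CWGraph

/-- The Euler characteristic can be computed on a deformation retract. -/
lemma HasEulerCharacteristic.of_retraction {X Y : Type u} [TopologicalSpace X]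
    [TopologicalSpace Y] {χ : ℤ} (hY : HasEulerCharacteristic Y χ) {f : X → Y} {g : Y → X}
    (hf : Continuous f) (hg : Continuous g) (hfg : ∀ y, f (g y) = y) {H : unitInterval × X → X}
    (hH : Continuous H) (h0 : ∀ x, H (0, x) = x) (h1 : ∀ x, H (1, x) = g (f x)) :
    HasEulerCharacteristic X χ := by
  refine HasEulerCharacteristic.of_homotopyEquiv
    (⟨⟨g, hg⟩, ⟨f, hf⟩, ?_, ?_⟩ : ContinuousMap.HomotopyEquiv Y X) hY
  · have : (⟨f, hf⟩ : C(X, Y)).comp ⟨g, hg⟩ = ContinuousMap.id Y := ContinuousMap.ext hfg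
    rw [this]
  · exact ContinuousMap.Homotopic.symm ⟨⟨⟨H, hH⟩, h0, h1⟩⟩

/-- The values taken by the Euler characteristic of the sink configuration space with `m` vertices
after removing the midpoints of all but `k` edges. -/
lemma sum_euler_succ (m k n : ℕ) :
    (∑ i ∈ Finset.range (k + 2), (-1 : ℤ) ^ i * ((n + 1).choose i : ℤ) * ((k + 1).choose i : ℤ) *
        (i.factorial : ℤ) * (m : ℤ) ^ (n + 1 - i)) =
      (∑ i ∈ Finset.range (k + 1), (-1 : ℤ) ^ i * ((n + 1).choose i : ℤ) * (k.choose i : ℤ) *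
        (i.factorial : ℤ) * (m : ℤ) ^ (n + 1 - i)) -
      (n + 1) * ∑ i ∈ Finset.range (k + 1), (-1 : ℤ) ^ i * (n.choose i : ℤ) * (k.choose i : ℤ) *
        (i.factorial : ℤ) * (m : ℤ) ^ (n - i) := by
  have h1 : (∑ i ∈ Finset.range (k + 1), (-1 : ℤ) ^ i * ((n + 1).choose i : ℤ) *
      (k.choose i : ℤ) * (i.factorial : ℤ) * (m : ℤ) ^ (n + 1 - i)) =
      ∑ i ∈ Finset.range (k + 2), (-1 : ℤ) ^ i * ((n + 1).choose i : ℤ) *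
      (k.choose i : ℤ) * (i.factorial : ℤ) * (m : ℤ) ^ (n + 1 - i) := by
    rw [Finset.sum_range_succ _ (k + 1), Nat.choose_succ_self]
    simp
  rw [h1, Finset.sum_range_succ' _ (k + 1), Finset.sum_range_succ' _ (k + 1), Finset.mul_sum,
    add_sub_right_comm, ← Finset.sum_sub_distrib]
  refine congrArg₂ (· + ·) (Finset.sum_congr rfl fun i _ => ?_) (by simp)
  -- Pascal's rule in `k` leaves the term with `k.choose i`; absorption in `n` turns its factor
  -- (i+1)! into (n+1) · i!.
  have h2 : ((n + 1).choose (i + 1) : ℤ) * (i + 1) = (n + 1) * n.choose i := by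
    exact_mod_cast (Nat.add_one_mul_choose_eq n i).symm
  rw [Nat.choose_succ_succ' k i, Nat.factorial_succ, Nat.add_sub_add_right]
  push_cast
  linear_combination (-1 : ℤ) ^ (i + 1) * (k.choose i : ℤ) * (i.factorial : ℤ) *
    (m : ℤ) ^ (n - i) * h2

lemma prod_le_of_mem_of_le_one {ι : Type*} {s : Finset ι} {f : ι → ℝ}
    (h0 : ∀ i ∈ s, 0 ≤ f i) (h1 : ∀ i ∈ s, f i ≤ 1) {i : ι} (hi : i ∈ s) :
    ∏ j ∈ s, f j ≤ f i := by
  classical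
  rw [← Finset.mul_prod_erase s f hi]
  exact mul_le_of_le_one_right (h0 i hi) (Finset.prod_le_one
    (fun j hj => h0 j (Finset.mem_of_mem_erase hj)) fun j hj => h1 j (Finset.mem_of_mem_erase hj))

/-! ### Punctured sink configuration spaces and the recursion -/

namespace CWGraph

variable {G : CWGraph.{u}} {n : ℕ}

lemma sinkConf_injOn {x : Fin n → G.carrier} (hx : x ∈ G.sinkConf n) {i j : Fin n}
    (h : x i = x j) (hi : x i ∉ G.vertexSet) : i = j := by
  by_contra hij
  rcases hx i j hij with h' | h'
  · exact h' h
  · exact hi h'.2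

variable (G n) in
/-- The sink configurations that avoid the midpoints of the edges in `F`. -/
def punctured (F : Set G.E) : Set (Fin n → G.carrier) :=
  {x | x ∈ G.sinkConf n ∧ ∀ e ∈ F, ∀ j, 0 < radius e (x j)}

lemma punctured_empty : G.punctured n ∅ = G.sinkConf n := by
  simp [punctured]

lemma hasEulerCharacteristic_vertexConf :
    HasEulerCharacteristic {x : Fin n → G.carrier | ∀ i, x i ∈ G.vertexSet}
      ((Nat.card G.V : ℤ) ^ n) := by
  let k : (Fin n → G.V) → {x : Fin n → G.carrier | ∀ i, x i ∈ G.vertexSet} :=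
    fun v => ⟨fun i => G.vertex (v i), fun i => vertex_mem _⟩
  have hk : Function.Bijective k := by
    constructor
    · intro v w h
      ext i
      exact vertex_injective (congrFun (congrArg Subtype.val h) i)
    · rintro ⟨x, hx⟩
      choose v hv using fun i => exists_eq_vertex (hx i)
      exact ⟨v, Subtype.ext (funext fun i => (hv i).symm)⟩
  have : Finite {x : Fin n → G.carrier | ∀ i, x i ∈ G.vertexSet} := Finite.of_surjective k hk.2
  -- A finite subspace of a Hausdorff space is discrete.
  have h := hasEulerCharacteristic_of_finite {x : Fin n → G.carrier | ∀ i, x i ∈ G.vertexSet}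
  rw [← Nat.card_congr (Equiv.ofBijective k hk), Nat.card_fun, Nat.card_fin] at h
  exact_mod_cast h

/-- A collision after stretching either happens at a vertex or was already present, hence at a
vertex, and vertices stay fixed. -/
lemma stretch_mem_punctured {F : Set G.E} {x : Fin n → G.carrier} (hx : x ∈ G.punctured n F)
    (l : ℝ) : (fun i => stretch l (x i)) ∈ G.punctured n F := by
  refine ⟨fun i j hij => ?_, fun e he j => (hx.2 e he j).trans_le (radius_le_radius_stretch e l _)⟩
  rw [or_iff_not_imp_left, not_not]
  intro h
  refine ⟨h, (stretch_mem_or_eq h).elim id fun h' => ?_⟩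
  have h1 := ((hx.1 i j hij).resolve_left (not_not.2 h')).2
  obtain ⟨v, hv⟩ := exists_eq_vertex h1
  change stretch l (x i) ∈ _
  rw [hv, stretch_vertex]
  exact vertex_mem v

/-- Stretching by a sufficiently large factor, depending continuously on the configuration, sends
every point to a vertex. -/
lemma hasEulerCharacteristic_punctured_univ :
    HasEulerCharacteristic (G.punctured n Set.univ) ((Nat.card G.V : ℤ) ^ n) := by
  have := Fintype.ofFinite G.E
  -- All radii are at most 1, so their product is a continuous positive lower bound for each of
  -- them, and stretching by its inverse suffices.
  let P : (Fin n → G.carrier) → ℝ := fun x => ∏ j, ∏ e, radius e (x j)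
  have hP : Continuous P := by
    refine continuous_finsetProd _ fun j _ => continuous_finsetProd _ fun e _ => ?_
    exact (continuous_radius e).comp (continuous_apply j)
  have hpos : ∀ x : G.punctured n Set.univ, 0 < P x := fun x =>
    Finset.prod_pos fun j _ => Finset.prod_pos fun e _ => x.2.2 e trivial j
  have hle : ∀ (x : Fin n → G.carrier) j e, P x ≤ radius e (x j) := by
    intro x j e
    refine (prod_le_of_mem_of_le_one (f := fun j => ∏ e, radius e (x j))
      (fun j _ => Finset.prod_nonneg fun e _ => radius_nonneg e _)
      (fun j _ => Finset.prod_le_one (fun e _ => radius_nonneg e _)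
        fun e _ => radius_le_one e _) (Finset.mem_univ j)).trans
      (prod_le_of_mem_of_le_one (fun e _ => radius_nonneg e _)
        (fun e _ => radius_le_one e _) (Finset.mem_univ e))
  let L : G.punctured n Set.univ → ℝ := fun x => (P x)⁻¹
  have hL : Continuous L := (hP.comp continuous_subtype_val).inv₀ fun x => (hpos x).ne'
  have hs : ∀ {f : unitInterval × G.punctured n Set.univ → ℝ}, Continuous f →
      Continuous fun p => (⟨_, stretch_mem_punctured p.2.2 (f p)⟩ : G.punctured n Set.univ) := by
    intro f hf
    refine Continuous.subtype_mk (continuous_pi fun i => ?_) _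
    exact continuous_stretch.comp (hf.prodMk
      ((continuous_apply i).comp (continuous_subtype_val.comp continuous_snd)))
  refine hasEulerCharacteristic_vertexConf.of_retraction
    (f := fun x => ⟨fun i => stretch (L x) (x.1 i), fun i => stretch_mem_vertexSet fun e => ?_⟩)
    (g := fun y => ⟨y.1, ?_, fun e _ j => ?_⟩)
    (H := fun p => ⟨_, stretch_mem_punctured p.2.2 (1 + p.1 * (L p.2 - 1))⟩) ?_ ?_ ?_ ?_ ?_ ?_
  · rw [inv_mul_eq_div, one_le_div (hpos x)]
    exact hle _ _ _
  · exact fun i j _ => or_iff_not_imp_left.2 fun h => ⟨not_not.1 h, y.2 i⟩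
  · obtain ⟨v, hv⟩ := exists_eq_vertex (y.2 j)
    rw [hv, radius_vertex]
    exact one_pos
  · refine Continuous.subtype_mk (continuous_pi fun i => ?_) _
    exact continuous_stretch.comp (hL.prodMk ((continuous_apply i).comp continuous_subtype_val))
  · exact Continuous.subtype_mk continuous_subtype_val _
  · intro y
    refine Subtype.ext (funext fun i => ?_)
    obtain ⟨v, hv⟩ := exists_eq_vertex (y.2 i)
    change stretch _ (y.1 i) = y.1 i
    rw [hv, stretch_vertex]
  · exact hs (by fun_prop)
  · intro x
    refine Subtype.ext (funext fun i => ?_)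
    change stretch (1 + 0 * (L x - 1)) (x.1 i) = x.1 i
    rw [zero_mul, add_zero, stretch_one]
  · intro x
    refine Subtype.ext (funext fun i => ?_)
    change stretch (1 + 1 * (L x - 1)) (x.1 i) = stretch (L x) (x.1 i)
    rw [one_mul, add_sub_cancel]

/-- The sink configurations avoiding the midpoints of the edges in `F` whose `i`-th point lies on
the edge `e`, with coordinate in `D`, and is strictly closest to its midpoint. -/
def nearSet (e : G.E) (F : Set G.E) (i : Fin (n + 1)) (D : Set ℝ) :
    Set (Fin (n + 1) → G.carrier) :=
  {x | x ∈ G.punctured (n + 1) F ∧ radius e (x i) < 1 ∧ coord e (x i) ∈ D ∧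
    ∀ j, radius e (x i) < radius e (x (i.succAbove j))}

lemma insertNth_mem_nearSet {e : G.E} {F : Set G.E} (he : e ∉ F) (i : Fin (n + 1)) {D : Set ℝ}
    {s : ℝ} (hs : s ∈ D) (hs1 : |s| < 1) {y : Fin n → G.carrier} (hy : y ∈ G.punctured n F)
    (hsy : ∀ j, |s| < radius e (y j)) :
    (i.insertNth (G.edge e s) y : Fin (n + 1) → G.carrier) ∈ nearSet e F i D := by
  -- The inserted point has strictly smaller radius than all others, so it creates no collision.
  have hr : radius e (G.edge e s) = |s| := by rw [radius_edge, min_eq_right hs1.le]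
  have hne : ∀ j, G.edge e s ≠ y j := fun j h => (hsy j).ne (by rw [← h, hr])
  refine ⟨⟨fun a b hab => ?_, fun e' he' j => ?_⟩, ?_, ?_, fun j => ?_⟩
  · rcases (Fin.eq_self_or_eq_succAbove i a).imp_left Eq.symm with rfl | ⟨a, rfl⟩ <;>
      rcases (Fin.eq_self_or_eq_succAbove i b).imp_left Eq.symm with rfl | ⟨b, rfl⟩ <;>
      simp only [Fin.insertNth_apply_same, Fin.insertNth_apply_succAbove]
    · exact (hab rfl).elim
    · exact Or.inl (hne b)
    · exact Or.inl (hne a).symm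
    · exact hy.1 a b fun h => hab (h ▸ rfl)
  · rcases Fin.eq_self_or_eq_succAbove i j with rfl | ⟨j, rfl⟩ <;>
      simp only [Fin.insertNth_apply_same, Fin.insertNth_apply_succAbove]
    · rw [radius_edge_of_ne (fun h : e = e' => he (h ▸ he'))]
      exact one_pos
    · exact hy.2 e' he' j
  · rwa [Fin.insertNth_apply_same, hr]
  · rwa [Fin.insertNth_apply_same, coord_edge e hs1]
  · rw [Fin.insertNth_apply_same, Fin.insertNth_apply_succAbove, hr]
    exact hsy j

lemma removeNth_mem_punctured {e : G.E} {F : Set G.E} {i : Fin (n + 1)} {D : Set ℝ}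
    {x : Fin (n + 1) → G.carrier} (hx : x ∈ nearSet e F i D) :
    i.removeNth x ∈ G.punctured n (insert e F) := by
  refine ⟨fun a b hab => hx.1.1 _ _ fun h => hab (Fin.succAbove_right_injective h), ?_⟩
  rintro e' (rfl | he') j
  · exact (radius_nonneg _ _).trans_lt (hx.2.2.2 j)
  · exact hx.1.2 e' he' _

/-- Forgetting the i-th point has as fibre over `y` the coordinates in `D` of absolute value below
all radii of `y`, a convex set. A section and a straight-line homotopy in the fibres give a homotopy
equivalence. -/
lemma hasEulerCharacteristic_nearSet {e : G.E} {F : Set G.E} (he : e ∉ F) (i : Fin (n + 1))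
    {D : Set ℝ} (hD : Convex ℝ D) (hD1 : ∀ s ∈ D, |s| < 1)
    (hDs : ∀ s ∈ D, ∀ r : ℝ, 0 < r → r ≤ 1 → s * r ∈ D) {c : ℝ} (hc : c ∈ D) {χ : ℤ}
    (h : HasEulerCharacteristic (G.punctured n (insert e F)) χ) :
    HasEulerCharacteristic (nearSet e F i D) χ := by
  let P : (Fin n → G.carrier) → ℝ := fun y => ∏ j, radius e (y j)
  have hP : Continuous P := continuous_finsetProd _ fun j _ =>
    (continuous_radius e).comp (continuous_apply j)
  have hpos : ∀ {y}, y ∈ G.punctured n (insert e F) → 0 < P y := fun hy =>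
    Finset.prod_pos fun j _ => hy.2 e (Set.mem_insert e F) j
  have hP1 : ∀ y, P y ≤ 1 := fun y =>
    Finset.prod_le_one (fun j _ => radius_nonneg e _) fun j _ => radius_le_one e _
  have hle : ∀ y j, P y ≤ radius e (y j) := fun y j =>
    prod_le_of_mem_of_le_one (fun j _ => radius_nonneg e _)
      (fun j _ => radius_le_one e _) (Finset.mem_univ j)
  -- The section puts the new point at coordinate `c * P y`: scaling keeps it in `D`, and |c| < 1
  -- makes it strictly closest to the midpoint.
  have hcD : ∀ {y}, y ∈ G.punctured n (insert e F) → c * P y ∈ D := fun hy =>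
    hDs c hc _ (hpos hy) (hP1 _)
  have hclt : ∀ {y}, y ∈ G.punctured n (insert e F) → ∀ j, |c * P y| < radius e (y j) := by
    intro y hy j
    rw [abs_mul, abs_of_pos (hpos hy)]
    exact (mul_lt_of_lt_one_left (hpos hy) (hD1 c hc)).trans_le (hle y j)
  have hmono : ∀ {y}, y ∈ G.punctured n (insert e F) → y ∈ G.punctured n F := fun hy =>
    ⟨hy.1, fun e' he' => hy.2 e' (Set.mem_insert_of_mem _ he')⟩
  have hmem : ∀ p : unitInterval × nearSet e F i D,
      (i.insertNth (G.edge e ((1 - p.1) * coord e (p.2.1 i) + p.1 * (c * P (i.removeNth p.2.1))))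
        (i.removeNth p.2.1) : Fin (n + 1) → G.carrier) ∈ nearSet e F i D := by
    rintro ⟨t, x, hx⟩
    have hy := removeNth_mem_punctured hx
    have hsD : (1 - (t : ℝ)) * coord e (x i) + t * (c * P (i.removeNth x)) ∈ D :=
      hD hx.2.2.1 (hcD hy) (sub_nonneg.2 t.2.2) t.2.1 (by ring)
    refine insertNth_mem_nearSet he i hsD (hD1 _ hsD) (hmono hy) fun j => ?_
    have hcv : Convex ℝ {s : ℝ | |s| < radius e (x (i.succAbove j))} := by
      have := convex_ball (0 : ℝ) (radius e (x (i.succAbove j)))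
      simpa [Metric.ball, Real.dist_eq] using this
    refine hcv ?_ (hclt hy j) (sub_nonneg.2 t.2.2) t.2.1 (by ring)
    exact (abs_coord hx.2.1).trans_lt (hx.2.2.2 j)
  have hrem : Continuous fun x : nearSet e F i D => i.removeNth x.1 :=
    continuous_pi fun j => (continuous_apply _).comp continuous_subtype_val
  have hco : Continuous fun x : nearSet e F i D => coord e (x.1 i) :=
    (continuousOn_coord e).comp_continuous
      ((continuous_apply i).comp continuous_subtype_val) fun x => x.2.2.1
  refine h.of_retraction (f := fun x => ⟨i.removeNth x.1, removeNth_mem_punctured x.2⟩)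
    (g := fun y => ⟨i.insertNth (G.edge e (c * P y.1)) y.1, insertNth_mem_nearSet he i (hcD y.2)
      (hD1 _ (hcD y.2)) (hmono y.2) (hclt y.2)⟩)
    (H := fun p => ⟨_, hmem p⟩) ?_ ?_ ?_ ?_ ?_ ?_
  · exact hrem.subtype_mk _
  · refine Continuous.subtype_mk (Continuous.finInsertNth (A := fun _ => G.carrier) i ?_
      continuous_subtype_val) _
    exact (continuous_edge e).comp (continuous_const.mul (hP.comp continuous_subtype_val))
  · intro y
    refine Subtype.ext ?_
    simp
  · refine Continuous.subtype_mk (Continuous.finInsertNth (A := fun _ => G.carrier) i ?_ (hrem.comp continuous_snd)) _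
    refine (continuous_edge e).comp (Continuous.add (Continuous.mul (by fun_prop)
      (hco.comp continuous_snd)) (Continuous.mul (by fun_prop) (continuous_const.mul
        (hP.comp (hrem.comp continuous_snd)))))
  · intro x
    refine Subtype.ext ?_
    simp [edge_coord x.2.2.1]
  · intro x
    refine Subtype.ext ?_
    simp

/-- The cover by `A` and the disjoint sets `B i` contributes `a` from `A`, `b` from each `B i` and
`2b` from each overlap `A ∩ B i`. -/
lemma hasEulerCharacteristic_punctured_succ {e : G.E} {F : Set G.E} (he : e ∉ F) {a b : ℤ}
    (ha : HasEulerCharacteristic (G.punctured (n + 1) (insert e F)) a)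
    (hb : HasEulerCharacteristic (G.punctured n (insert e F)) b) :
    HasEulerCharacteristic (G.punctured (n + 1) F) (a - (n + 1) * b) := by
  have hcx : ∀ i : Fin (n + 1), Continuous fun x : Fin (n + 1) → G.carrier => radius e (x i) :=
    fun i => (continuous_radius e).comp (continuous_apply i)
  let A : Set (Fin (n + 1) → G.carrier) := {x | ∀ j, 0 < radius e (x j)}
  let B (i : Fin (n + 1)) : Set (Fin (n + 1) → G.carrier) :=
    {x | radius e (x i) < 1 ∧ ∀ j, radius e (x i) < radius e (x (i.succAbove j))}
  have hA : IsOpen A := by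
    simp only [A, Set.ofPred_forall]
    exact isOpen_iInter_of_finite fun j => isOpen_lt continuous_const (hcx j)
  have hB : ∀ i, IsOpen (B i) := by
    intro i
    simp only [B, Set.ofPred_and, Set.ofPred_forall]
    exact (isOpen_lt (hcx i) continuous_const).inter
      (isOpen_iInter_of_finite fun j => isOpen_lt (hcx i) (hcx _))
  have hBd : ∀ i j, i ≠ j → Disjoint (B i) (B j) := by
    intro i j hij
    rw [Set.disjoint_left]
    intro x hi hj
    obtain ⟨k, rfl⟩ := Fin.exists_succAbove_eq hij.symm
    obtain ⟨l, hl⟩ := Fin.exists_succAbove_eq hij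
    have h1 := hi.2 k
    have h2 := hj.2 l
    rw [hl] at h2
    exact lt_asymm h1 h2
  have hSA : G.punctured (n + 1) (insert e F) = G.punctured (n + 1) F ∩ A := by
    ext x
    simp only [punctured, A, Set.mem_inter_iff, Set.mem_ofPred_eq, Set.forall_mem_insert]
    tauto
  -- Outside `A` some point is at the midpoint of `e`. This is not a vertex, so no other point is
  -- there, and that point is strictly closest.
  have hcov : G.punctured (n + 1) F ⊆ A ∪ ⋃ i ∈ (Finset.univ : Finset (Fin (n + 1))), B i := by
    intro x hx
    by_cases hxA : x ∈ A
    · exact Or.inl hxA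
    · right
      simp only [A, Set.mem_ofPred_eq, not_forall, not_lt] at hxA
      obtain ⟨i, hi⟩ := hxA
      have hz : ∀ {j}, radius e (x j) ≤ 0 → x j = G.edge e 0 := by
        intro j hj
        have h1 : radius e (x j) < 1 := hj.trans_lt one_pos
        have h2 := abs_coord h1
        rw [← edge_coord h1, abs_nonpos_iff.1 (h2.trans_le hj)]
      refine Set.mem_iUnion₂.2 ⟨i, Finset.mem_univ i, hi.trans_lt one_pos, fun j => ?_⟩
      by_contra! hj
      refine Fin.succAbove_ne i j (sinkConf_injOn hx.1 ?_
        (not_mem_vertexSet_of_radius_lt (e := e) ((hj.trans hi).trans_lt one_pos)))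
      rw [hz hi, hz (hj.trans hi)]
  have hW : ∀ i, HasEulerCharacteristic (G.punctured (n + 1) F ∩ B i : Set _) b := by
    intro i
    have : G.punctured (n + 1) F ∩ B i = nearSet e F i (Set.Ioo (-1) 1) := by
      ext x
      refine ⟨fun h => ⟨h.1, h.2.1, ?_, h.2.2⟩, fun h => ⟨h.1, h.2.1, h.2.2.2⟩⟩
      exact abs_lt.1 ((abs_coord h.2.1).trans_lt h.2.1)
    rw [this]
    refine hasEulerCharacteristic_nearSet he i (convex_Ioo _ _) (fun s hs => abs_lt.2 hs) ?_
      (c := 0) (by norm_num) hb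
    rintro s ⟨h1, h2⟩ r h3 h4
    constructor <;> nlinarith
  have hW' : ∀ i, HasEulerCharacteristic (G.punctured (n + 1) (insert e F) ∩ B i : Set _)
      (b + b) := by
    intro i
    have hcont : Continuous fun x : Fin (n + 1) → G.carrier =>
        coord e (x i) * (1 - radius e (x i)) := (continuous_coord_mul e).comp (continuous_apply i)
    have hpos : G.punctured (n + 1) (insert e F) ∩ B i ∩
        {x | 0 < coord e (x i) * (1 - radius e (x i))} = nearSet e F i (Set.Ioo 0 1) := by
      rw [hSA]
      ext x
      constructor
      · rintro ⟨⟨⟨h1, h2⟩, h3⟩, h4⟩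
        have h5 := (abs_coord h3.1).trans_lt h3.1
        exact ⟨h1, h3.1, ⟨pos_of_mul_pos_left h4 (sub_pos.2 h3.1).le, (abs_lt.1 h5).2⟩, h3.2⟩
      · rintro ⟨h1, h2, h3, h4⟩
        refine ⟨⟨⟨h1, fun j => ?_⟩, h2, h4⟩, mul_pos h3.1 (sub_pos.2 h2)⟩
        have h5 : 0 < radius e (x i) := abs_coord h2 ▸ abs_pos.2 h3.1.ne'
        rcases Fin.eq_self_or_eq_succAbove i j with rfl | ⟨j, rfl⟩
        · exact h5
        · exact h5.trans (h4 j)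
    have hneg : G.punctured (n + 1) (insert e F) ∩ B i ∩
        {x | coord e (x i) * (1 - radius e (x i)) < 0} = nearSet e F i (Set.Ioo (-1) 0) := by
      rw [hSA]
      ext x
      constructor
      · rintro ⟨⟨⟨h1, h2⟩, h3⟩, h4⟩
        have h5 := (abs_coord h3.1).trans_lt h3.1
        exact ⟨h1, h3.1, ⟨(abs_lt.1 h5).1, neg_of_mul_neg_left h4 (sub_pos.2 h3.1).le⟩, h3.2⟩
      · rintro ⟨h1, h2, h3, h4⟩
        refine ⟨⟨⟨h1, fun j => ?_⟩, h2, h4⟩, mul_neg_of_neg_of_pos h3.2 (sub_pos.2 h2)⟩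
        have h5 : 0 < radius e (x i) := abs_coord h2 ▸ abs_pos.2 h3.2.ne
        rcases Fin.eq_self_or_eq_succAbove i j with rfl | ⟨j, rfl⟩
        · exact h5
        · exact h5.trans (h4 j)
    -- The overlap is split by the sign of the coordinate, nonzero because the midpoint is excluded;
    -- the two halves are disjoint.
    rw [← sub_zero (b + b)]
    refine HasEulerCharacteristic.of_cover
      (A := {x | 0 < coord e (x i) * (1 - radius e (x i))})
      (B := {x | coord e (x i) * (1 - radius e (x i)) < 0}) (isOpen_lt continuous_const hcont)
      (isOpen_lt hcont continuous_const) (fun x hx => ?_) ?_ ?_ ?_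
    · refine (mul_ne_zero ?_ (sub_pos.2 hx.2.1).ne').lt_or_gt.symm
      rw [← abs_pos, abs_coord hx.2.1]
      exact hx.1.2 e (Set.mem_insert e F) i
    · rw [hpos]
      refine hasEulerCharacteristic_nearSet he i (convex_Ioo _ _)
        (fun s hs => abs_lt.2 ⟨by linarith [hs.1], hs.2⟩) ?_ (c := 1 / 2) (by norm_num) hb
      rintro s ⟨h1, h2⟩ r h3 h4
      constructor <;> nlinarith
    · rw [hneg]
      refine hasEulerCharacteristic_nearSet he i (convex_Ioo _ _)
        (fun s hs => abs_lt.2 ⟨hs.1, by linarith [hs.2]⟩) ?_ (c := -1 / 2) (by norm_num) hb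
      rintro s ⟨h1, h2⟩ r h3 h4
      constructor <;> nlinarith
    · have : IsEmpty (G.punctured (n + 1) (insert e F) ∩ B i ∩
          ({x | 0 < coord e (x i) * (1 - radius e (x i))} ∩
            {x | coord e (x i) * (1 - radius e (x i)) < 0}) : Set (Fin (n + 1) → G.carrier)) :=
        ⟨fun x => lt_asymm (show 0 < coord e (x.1 i) * (1 - radius e (x.1 i)) from x.2.2.1)
          x.2.2.2⟩
      exact hasEulerCharacteristic_of_isEmpty _
  have hX := HasEulerCharacteristic.iUnion Finset.univ (G.punctured (n + 1) F) B
    (fun i _ => hB i) (fun i _ j _ => hBd i j) (fun _ => b) fun i _ => hW i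
  have hY := HasEulerCharacteristic.iUnion Finset.univ (G.punctured (n + 1) (insert e F)) B
    (fun i _ => hB i) (fun i _ j _ => hBd i j) (fun _ => b + b) fun i _ => hW' i
  rw [hSA, Set.inter_assoc] at hY
  rw [hSA] at ha
  -- Here a + (n+1) b - (n+1)(b + b) = a - (n+1) b.
  convert HasEulerCharacteristic.of_cover hA (isOpen_biUnion fun i _ => hB i) hcov ha hX hY using 1
  simp
  ring

lemma hasEulerCharacteristic_punctured (n k : ℕ) (F : Set G.E) (hF : Fᶜ.ncard = k) :
    HasEulerCharacteristic (G.punctured n F)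
      (∑ i ∈ Finset.range (k + 1), (-1 : ℤ) ^ i * (n.choose i : ℤ) * (k.choose i : ℤ) *
        (i.factorial : ℤ) * (Nat.card G.V : ℤ) ^ (n - i)) := by
  induction k generalizing n F with
  | zero =>
    obtain rfl : F = Set.univ := Set.compl_empty_iff.1 ((Set.ncard_eq_zero).1 hF)
    simpa using hasEulerCharacteristic_punctured_univ (G := G) (n := n)
  | succ k ih =>
    obtain ⟨e, he⟩ : Fᶜ.Nonempty := by
      rw [← Set.ncard_pos, hF]; exact k.succ_pos
    have hF' : (insert e F)ᶜ.ncard = k := by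
      rw [← Set.union_singleton, Set.compl_union, ← Set.sdiff_eq, Set.ncard_sdiff_singleton_of_mem he,
        hF, Nat.add_sub_cancel]
    cases n with
    | zero =>
      -- With no points the puncture condition is vacuous, and both sums reduce to their term `i =
      -- 0`, which is 1.
      have h := ih 0 _ hF'
      have : G.punctured 0 F = G.punctured 0 (insert e F) := by
        ext x
        simp [punctured]
      rw [this]
      convert h using 1
      have hz : ∀ m : ℕ, ∑ i ∈ Finset.range (m + 1), (-1 : ℤ) ^ i * (Nat.choose 0 i : ℤ) *
          (m.choose i : ℤ) * (i.factorial : ℤ) * (Nat.card G.V : ℤ) ^ (0 - i) = 1 := fun m => by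
        rw [Finset.sum_range_succ']
        simp
      rw [hz, hz]
    | succ n =>
      rw [sum_euler_succ]
      exact hasEulerCharacteristic_punctured_succ he (ih _ _ hF') (ih _ _ hF')

lemma hasEulerCharacteristic_sinkConf (G : CWGraph.{u}) (n : ℕ) :
    HasEulerCharacteristic (G.sinkConf n)
      (∑ i ∈ Finset.range (Nat.card G.E + 1),
        (-1 : ℤ) ^ i * (n.choose i : ℤ) * ((Nat.card G.E).choose i : ℤ) * (i.factorial : ℤ) *
          (Nat.card G.V : ℤ) ^ (n - i)) := by
  have h := hasEulerCharacteristic_punctured (G := G) n (Nat.card G.E) ∅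
    (by rw [Set.compl_empty, Set.ncard_univ])
  rwa [punctured_empty] at h

end CWGraph

end

theorem mainTheorem10 (n : ℕ) :
    (∀ G : CWGraph.{u}, HasEulerCharacteristic (G.sinkConf n)
      (∑ i ∈ Finset.range (Nat.card G.E + 1),
        (-1 : ℤ) ^ i * (n.choose i : ℤ) * ((Nat.card G.E).choose i : ℤ) * (i.factorial : ℤ) *
          (Nat.card G.V : ℤ) ^ (n - i))) ∧
    (∀ (G : CWGraph.{u}) (G' : CWGraph.{v}),
      Nat.card G.E = Nat.card G'.E → Nat.card G.V = Nat.card G'.V →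
        ∃ χ : ℤ, HasEulerCharacteristic (G.sinkConf n) χ ∧
          HasEulerCharacteristic (G'.sinkConf n) χ) := by
  exact ⟨fun G => G.hasEulerCharacteristic_sinkConf n, fun G G' hE hV =>
    ⟨_, G.hasEulerCharacteristic_sinkConf n, by
      rw [hE, hV]
      exact G'.hasEulerCharacteristic_sinkConf n⟩⟩
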